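/- **Theorem 2.** Consider the Poisson topic model: a label $y\in\{0,1\}$ is drawn from a Bernoulli law; given $y$, a topic $\tau\in\{1,\dots,T\}$ is drawn from a law $\rho_y$; given $\tau$, the word counts $x_1,\dots,x_d$ are independent with $x_j\sim\mathrm{Poisson}(\lambda^{(\tau)}_j)$, $\lambda_j^{(\tau)}\in[0,\infty)$. Let $\lambda=\min_\tau\sum_j\lambda_j^{(\tau)}$. Let $\delta\in(0,1)$ and let $\tilde x$ be the dropout version of $x$: given $x$, the $\tilde x_j\sim\mathrm{Binom}(x_j,1-\delta)$ are independent. Linear rules are $h(x)=\mathbf 1\{w\cdot x>0\}$, $w\in\mathbb R^d$, with $\mathrm{Err}(h)=\mathbb P[y\ne h(x)]$ and $\mathrm{Err}_\delta(h)=\mathbb P[y\neq h(\tilde x)]$. Assume: 1. (well-balanced weights) a constant $\kappa>0$ is given, and $w$ (or its rule) is called *well-balanced* if for every topic $\tau$, $\sum_j\lambda^{(\tau)}_jw_j^2>0$ and $$\frac{\max_j\{w_j^2\}\,\sum_j\lambda_j^{(\tau)}}{\sum_j\lambda_j^{(\tau)}w_j^2}\le\kappa ;$$ 2. (discrete topics)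 for some $p_{\min},\alpha>0$, every topic $\tau$ and $c\in\{0,1\}$: $\mathbb P[\tau]\ge p_{\min}$ and $\left|\mathbb P[y=c\mid\tau]-\tfrac12\right|\ge\alpha$; 3. (distinct topics) a minimizer $h^*_\delta$ of $\mathrm{Err}_\delta$ over the well-balanced linear rules exists and satisfies $\mathrm{Err}_\delta(h^*_\delta)\le\mathrm{Err}_{\min}+B/\sqrt\lambda$, where $\mathrm{Err}_{\min}=\mathbb P[y\ne c_\tau]$ and $c_\tau$ is the more likely label given the topic $\tau$. For an arbitrary training sample $(x^{(i)},y^{(i)})_{i\le n}$ let $\hat h_\delta$ be a dropout empirical risk minimizer over the well-balanced linear rules, i.e. a minimizer of $\sum_{i}\mathbb E\big[\mathbf 1\{h(\tilde x^{(i)})\ne y^{(i)}\}\big]$, the expectation being over the dropout noise only. Put $$\tilde\eta=\mathrm{Err}_\delta(\hat h_\delta)-\mathrm{Err}_\delta(h^*_\delta),\qquad \eta=\mathrm{Err}(\hat h_\delta)-\mathrm{Err}(h^*_\delta),\qquad L=\max\Big\{1,\sqrt{-\log\tilde\eta}^{\;\frac{\delta}{1-\delta}}\Big\}.$$ Then there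 is a constant $K$, depending only on $\kappa$ and $B$ (not on $\delta,d,T,n,p_{\min},\alpha$, the model, the sample or the rules), such that $$\eta\;\le\;\Big(\frac{K}{\sqrt{1-\delta}}\Big)^{\frac1{1-\delta}}\left[\Big(\frac{\tilde\eta}{\alpha\,p_{\min}}\Big)^{\frac1{1-\delta}}L+\frac1{\sqrt\lambda}\right],$$ and, if moreover $\delta\le\frac12$, $$\eta\;\le\;\frac{K}{\alpha\,p_{\min}}\left[\tilde\eta^{\frac1{1-\delta}}L+\frac1{\sqrt\lambda}\right].$$ In both displays $\tilde\eta^{1/(1-\delta)}L$ is read as $0$ when $\tilde\eta=0$. In particular, up to logarithmic factors, $\eta=\widetilde O\big(\tilde\eta^{1/(1-\delta)}+1/\sqrt\lambda\big)$. -/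

import Mathlib

open MeasureTheory ProbabilityTheory
open scoped NNReal

noncomputable section

/-- A Poisson topic model with `d` words and `T` topics: a (Bernoulli) law of the label
(`true` is label 1, `false` is label 0), for each label a law on the topics, and for each topic and
word the expected number `rate τ j ∈ [0, ∞)` of occurrences of word `j` under topic `τ`. -/
structure PoissonTopicModel (d T : ℕ) where
  labelLaw : PMF Bool
  topicLaw : Bool → PMF (Fin T)
  rate : Fin T → Fin d → ℝ≥0

/-- Binomial dropout of the count vector `x`: the counts are thinned independently,
`x̃ j ∼ Binom (x j, 1 - δ)`. -/
def thinLaw {d : ℕ} (δ : unitInterval) (x : Fin d → ℕ) : PMF (Fin d → ℕ) :=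
  (Measure.pi fun j => binomial (x j) (unitInterval.symm δ)).toPMF

/-- The linear decision rule `x ↦ 1{w · x > 0}`. -/
def linearRule {d : ℕ} (w : Fin d → ℝ) (x : Fin d → ℕ) : Bool :=
  decide (0 < ∑ j, w j * (x j : ℝ))

/-- The zero-one loss of the linear rule with weights `w` on the example `(x, y)`. -/
def zeroOneLoss {d : ℕ} (w : Fin d → ℝ) (x : Fin d → ℕ) (y : Bool) : ℝ :=
  if linearRule w x ≠ y then 1 else 0

/-- The empirical dropout risk `∑ i, 𝔼 ℓ(w; x̃⁽ⁱ⁾, y⁽ⁱ⁾)` of the training sample `(x⁽ⁱ⁾, y⁽ⁱ⁾)`,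
with the expectation taken over the dropout noise only. -/
def empDropRisk {d n : ℕ} (δ : unitInterval) (sample : Fin n → (Fin d → ℕ) × Bool)
    (w : Fin d → ℝ) : ℝ :=
  ∑ i, ∫ x', zeroOneLoss w x' (sample i).2 ∂(thinLaw δ (sample i).1).toMeasure

namespace PoissonTopicModel

variable {d T : ℕ} (M : PoissonTopicModel d T)

/-- The law of the word counts given the topic: independent Poisson variables. -/
def wordLaw (τ : Fin T) : PMF (Fin d → ℕ) :=
  (Measure.pi fun j => poissonMeasure (M.rate τ j)).toPMF

/-- The data-generating law, of `(y, τ, x)`: label, topic, document. -/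
def dataLaw : PMF (Bool × Fin T × (Fin d → ℕ)) :=
  M.labelLaw.bind fun y =>
    (M.topicLaw y).bind fun τ =>
      (M.wordLaw τ).map fun x => (y, τ, x)

/-- The law of `(y, τ, x̃)`: label, topic, document after dropout. -/
def dropLaw (δ : unitInterval) : PMF (Bool × Fin T × (Fin d → ℕ)) :=
  M.dataLaw.bind fun ω => (thinLaw δ ω.2.2).map fun x' => (ω.1, ω.2.1, x')

/-- `Err h = ℙ (y ≠ h x)`, for the linear rule `h` with weights `w`. -/
def err (w : Fin d → ℝ) : ℝ :=
  M.dataLaw.toMeasure.real {ω | ω.1 ≠ linearRule w ω.2.2}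

/-- `Err_δ h = ℙ (y ≠ h x̃)`, for the linear rule `h` with weights `w`. -/
def errDrop (δ : unitInterval) (w : Fin d → ℝ) : ℝ :=
  (M.dropLaw δ).toMeasure.real {ω | ω.1 ≠ linearRule w ω.2.2}

/-- `ℙ (τ)`. -/
def topicProb (τ : Fin T) : ℝ :=
  M.dataLaw.toMeasure.real {ω | ω.2.1 = τ}

/-- `ℙ (y = c | τ)`. -/
def labelProb (c : Bool) (τ : Fin T) : ℝ :=
  (M.dataLaw.toMeasure[|{ω | ω.2.1 = τ}]).real {ω | ω.1 = c}

/-- The more likely label `c_τ` given the topic `τ`. -/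
def bestLabel (τ : Fin T) : Bool :=
  decide (M.labelProb false τ < M.labelProb true τ)

/-- `Err_min = ℙ (y ≠ c_τ)`, the error rate of the optimal rule that sees the topic. -/
def errMin : ℝ :=
  M.dataLaw.toMeasure.real {ω | ω.1 ≠ M.bestLabel ω.2.1}

/-- `‖λ^(τ)‖₁`, the average length of a document with topic `τ`. -/
def docLength (τ : Fin T) : ℝ := ∑ j, (M.rate τ j : ℝ)

/-- `λ = min_τ ‖λ^(τ)‖₁`, the shortest average document length across topics. -/
def minLength : ℝ := ⨅ τ, M.docLength τ

/-- Weights `w` are well-balanced with constant `κ`: for every topic,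
`max_j w_j² * ∑ j, λ_j / ∑ j, λ_j w_j² ≤ κ` (with a nonzero denominator). -/
def WellBalanced (κ : ℝ) (w : Fin d → ℝ) : Prop :=
  ∀ τ, 0 < ∑ j, (M.rate τ j : ℝ) * w j ^ 2 ∧
    (⨆ j, w j ^ 2) * (∑ j, (M.rate τ j : ℝ)) / (∑ j, (M.rate τ j : ℝ) * w j ^ 2) ≤ κ

/-- `w` gives a best linear rule `h*_δ` on the dropout measure among the well-balanced ones. -/
def IsBestDropRule (κ : ℝ) (δ : unitInterval) (w : Fin d → ℝ) : Prop :=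
  M.WellBalanced κ w ∧ ∀ v, M.WellBalanced κ v → M.errDrop δ w ≤ M.errDrop δ v

/-- `w` gives a dropout empirical risk minimizer `ĥ_δ` on the given training sample, among the
well-balanced linear rules. -/
def IsDropERM {n : ℕ} (κ : ℝ) (δ : unitInterval) (sample : Fin n → (Fin d → ℕ) × Bool)
    (w : Fin d → ℝ) : Prop :=
  M.WellBalanced κ w ∧
    ∀ v, M.WellBalanced κ v → empDropRisk δ sample w ≤ empDropRisk δ sample v

end PoissonTopicModel

end

/-!
Under topic `τ` the score `∑ j, w j * x j` is a weighted sum of independent Poisson counts, with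
mean `μ` and variance `σ²`. Dropout thins the counts, and a thinned Poisson count is Poisson with
its rate multiplied by `1 - δ` (`poissonPi_bind_thinLaw`). So dropout multiplies the
signal-to-noise ratio `z = μ / σ` by `√(1 - δ)` (`signedMargin_smul`). The proof compares the
probabilities of error at `z` and at `√(1 - δ) z`.

*Normal approximation.* A well-balanced rule has `max |w j| ≤ √(κ / λ) σ`, and then the
distribution function of the standardized score is within `7 √(κ / λ)` of the Gaussian one
(`abs_measureReal_centeredSum_le_sub_gaussCDF`). This Berry-Esseen bound is proved by Stein's
method. For Poisson counts the Mecke formula `𝔼 [x j g(x)] = r j 𝔼 [g(x + e j)]` gives the identity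
`𝔼 [W g(W)] = ∑ j, r j u j 𝔼 [g(W + u j) - g(W)]` for `W = ∑ j, u j (x j - r j)` exactly. Applied
to a truncated linear function it bounds the mass of short intervals, and then it is applied to the
solution of the Gaussian Stein equation, whose Taylor expansion is good except across its kink.

*Gaussian tails.* The Mills ratio is of order `1 / (1 + x)`, so the tail at `z` is at most the
`1 / (1 - δ)`-th power of the tail `t` at `√(1 - δ) z`, up to a factor `C ^ (1 / (1 - δ))` and a
power `δ / (1 - δ)` of `√(-log t)` (`gaussCDF_neg_le_riskTransfer`).

*Averaging over topics.* The excess of the risk over `errMin` is `∑ τ, q τ * ε τ`, where `ε τ` is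
the probability of deciding against the more likely label, and `2 α pmin ≤ q τ`, `∑ τ, q τ ≤ 1`;
the same holds with dropout (`err_sub_errMin`, `errDrop_sub_errMin`). If the excess dropout risk
`ηdrop` is at most `1 / √λ`, it is enough that the tail at `z` is at most twice the one at
`√(1 - δ) z`. Otherwise the term `B / √λ` is absorbed into `ηdrop`, and the tail comparison is
summed over the topics, with the lower bound on `q` used either inside the power
(`sum_mul_le_riskTransfer_div`) or, for `δ ≤ 1 / 2`, for the exponent `δ / (1 - δ) ≤ 1` only
(`sum_mul_le_div_mul_riskTransfer`).
-/

/-! ### The Gaussian distribution function and its Mills ratio -/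

/-- The standard Gaussian distribution function without its normalization `1 / √(2π)`. -/
noncomputable def gaussInt (x : ℝ) : ℝ := ∫ t in Set.Iic x, Real.exp (-(t ^ 2) / 2)

/-- The standard Gaussian distribution function. -/
noncomputable def gaussCDF (x : ℝ) : ℝ := gaussInt x / √(2 * Real.pi)

/-- The Mills ratio `e^{x²/2} ∫_{-∞}^x e^{-t²/2} dt`. -/
noncomputable def mills (x : ℝ) : ℝ := Real.exp (x ^ 2 / 2) * gaussInt x

lemma integrable_gauss : Integrable fun t : ℝ => Real.exp (-(t ^ 2) / 2) := by
  have := integrable_exp_neg_mul_sq (b := 1 / 2) (by norm_num)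
  refine this.congr (ae_of_all _ fun t => ?_)
  simp only []
  congr 1; ring

lemma hasDerivAt_gaussInt (x : ℝ) : HasDerivAt gaussInt (Real.exp (-(x ^ 2) / 2)) x := by
  have h : gaussInt = fun x => gaussInt 0 + ∫ t in (0 : ℝ)..x, Real.exp (-(t ^ 2) / 2) := by
    funext y
    rw [← intervalIntegral.integral_Iic_sub_Iic integrable_gauss.integrableOn
      integrable_gauss.integrableOn]
    simp [gaussInt]
  rw [h]
  refine HasDerivAt.const_add _ ?_
  have hc : Continuous fun t : ℝ => Real.exp (-(t ^ 2) / 2) := by fun_prop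
  exact intervalIntegral.integral_hasDerivAt_right (hc.intervalIntegrable _ _)
    (hc.stronglyMeasurableAtFilter _ _) hc.continuousAt

lemma gaussInt_neg_eq (x : ℝ) : gaussInt (-x) = ∫ t in Set.Ioi x, Real.exp (-(t ^ 2) / 2) := by
  rw [gaussInt, ← integral_comp_neg_Ioi]
  simp

lemma gaussInt_add_neg (x : ℝ) : gaussInt x + gaussInt (-x) = √(2 * Real.pi) := by
  rw [gaussInt_neg_eq, gaussInt, ← setIntegral_union (Set.Iic_disjoint_Ioi le_rfl)
    measurableSet_Ioi integrable_gauss.integrableOn integrable_gauss.integrableOn,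
    Set.Iic_union_Ioi, setIntegral_univ]
  have := integral_gaussian (1 / 2)
  rw [show Real.pi / (1 / 2) = 2 * Real.pi by ring] at this
  rw [← this]
  congr 1; funext t; congr 1; ring

/-- The Mills ratio in the tail as a Laplace transform. -/
lemma mills_neg_eq (x : ℝ) :
    mills (-x) = ∫ s in Set.Ioi (0 : ℝ), Real.exp (-x * s - s ^ 2 / 2) := by
  rw [mills, gaussInt_neg_eq, ← integral_const_mul]
  have := (measurePreserving_add_right volume x).setIntegral_preimage_emb
    (MeasurableEquiv.addRight x).measurableEmbedding
    (fun t : ℝ => Real.exp ((-x) ^ 2 / 2) * Real.exp (-(t ^ 2) / 2)) (Set.Ioi x)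
  rw [Set.preimage_add_const_Ioi, sub_self] at this
  rw [← this]
  congr 1; funext s
  rw [← Real.exp_add]; congr 1; ring

lemma integrable_mills (x : ℝ) : Integrable fun s : ℝ => Real.exp (-x * s - s ^ 2 / 2) := by
  have := (integrable_gauss.comp_add_right x).const_mul (Real.exp (x ^ 2 / 2))
  refine this.congr (ae_of_all _ fun t => ?_)
  simp only []
  rw [← Real.exp_add]; congr 1; ring

lemma gaussInt_pos (x : ℝ) : 0 < gaussInt x := by
  rw [gaussInt]
  refine (setIntegral_pos_iff_support_of_nonneg_ae (ae_of_all _ fun t => (Real.exp_pos _).le)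
    integrable_gauss.integrableOn).2 ?_
  have : Function.support (fun t : ℝ => Real.exp (-(t ^ 2) / 2)) = Set.univ := by
    ext t; simp [Real.exp_ne_zero]
  simp [this]

lemma mills_pos (x : ℝ) : 0 < mills x := mul_pos (Real.exp_pos _) (gaussInt_pos x)

lemma hasDerivAt_mills (x : ℝ) : HasDerivAt mills (x * mills x + 1) x := by
  have h1 : HasDerivAt (fun y : ℝ => Real.exp (y ^ 2 / 2)) (Real.exp (x ^ 2 / 2) * x) x := by
    have : HasDerivAt (fun y : ℝ => y ^ 2 / 2) x x := by
      simpa using (hasDerivAt_pow 2 x).div_const 2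
    exact this.exp
  have := h1.mul (hasDerivAt_gaussInt x)
  refine this.congr_deriv ?_
  rw [← Real.exp_add, mills]
  rw [show x ^ 2 / 2 + -x ^ 2 / 2 = 0 by ring, Real.exp_zero]; ring

lemma mills_neg_le_two {x : ℝ} (hx : 0 ≤ x) : mills (-x) ≤ 2 := by
  have h0 : mills (-x) ≤ ∫ s in Set.Ioi (0 : ℝ), Real.exp (-0 * s - s ^ 2 / 2) := by
    rw [mills_neg_eq]
    refine setIntegral_mono_on (integrable_mills x).integrableOn (integrable_mills 0).integrableOn
      measurableSet_Ioi fun s hs => ?_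
    have := mul_nonneg hx (le_of_lt hs)
    exact Real.exp_le_exp.2 (by linarith)
  refine h0.trans ?_
  have h2 := integral_gaussian_Ioi (1 / 2)
  have h3 : (∫ s in Set.Ioi (0 : ℝ), Real.exp (-0 * s - s ^ 2 / 2)) = √(Real.pi / (1 / 2)) / 2 := by
    rw [← h2]; congr 1; funext s; congr 1; ring
  rw [h3]
  have : √(Real.pi / (1 / 2)) ≤ 4 := by
    rw [Real.sqrt_le_left (by norm_num)]; linarith [Real.pi_lt_four]
  linarith

lemma mul_mills_neg_le_one {x : ℝ} (hx : 0 ≤ x) : x * mills (-x) ≤ 1 := by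
  rcases hx.eq_or_lt with rfl | hx
  · simp
  have h0 : mills (-x) ≤ ∫ s in Set.Ioi (0 : ℝ), Real.exp (-x * s) := by
    rw [mills_neg_eq]
    refine setIntegral_mono_on (integrable_mills x).integrableOn
      (integrableOn_exp_mul_Ioi (by linarith) 0) measurableSet_Ioi fun s hs => ?_
    gcongr; nlinarith [sq_nonneg s]
  rw [integral_exp_mul_Ioi (by linarith)] at h0
  have h1 : mills (-x) ≤ 1 / x := by simpa using h0
  rwa [le_div_iff₀ hx, mul_comm] at h1

lemma mills_neg_ge {x : ℝ} (hx : 0 ≤ x) : Real.exp (-(3 / 2)) / (1 + x) ≤ mills (-x) := by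
  have hp : 0 < 1 + x := by linarith
  have hI : IntegrableOn (fun s : ℝ => Real.exp (-x * s - s ^ 2 / 2)) (Set.Ioi 0) :=
    (integrable_mills x).integrableOn
  rw [mills_neg_eq]
  have h1 : (∫ _s in Set.Ioc (0 : ℝ) (1 / (1 + x)), Real.exp (-(3 / 2))) ≤
      ∫ s in Set.Ioc (0 : ℝ) (1 / (1 + x)), Real.exp (-x * s - s ^ 2 / 2) := by
    refine setIntegral_mono_on (by simp)
      (integrable_mills x).integrableOn measurableSet_Ioc fun s hs => ?_
    have h2 : (1 + x) * s ≤ 1 := by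
      have := hs.2; rw [le_div_iff₀ hp] at this; linarith
    have h3 : s ≤ 1 := by nlinarith [hs.1]
    gcongr; nlinarith [hs.1]
  have h2 : (∫ s in Set.Ioc (0 : ℝ) (1 / (1 + x)), Real.exp (-x * s - s ^ 2 / 2)) ≤
      ∫ s in Set.Ioi (0 : ℝ), Real.exp (-x * s - s ^ 2 / 2) :=
    setIntegral_mono_set hI (ae_of_all _ fun s => (Real.exp_pos _).le)
      (Set.Ioc_subset_Ioi_self).eventuallyLE
  refine le_trans (le_of_eq ?_) (h1.trans h2)
  have : (0 : ℝ) ≤ 1 / (1 + x) := by positivity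
  simp [hp.le]
  ring

lemma sqrt_two_pi_pos : 0 < √(2 * Real.pi) := Real.sqrt_pos.2 (by positivity)

lemma gaussCDF_pos (x : ℝ) : 0 < gaussCDF x := div_pos (gaussInt_pos x) sqrt_two_pi_pos

lemma gaussCDF_add_neg (x : ℝ) : gaussCDF x + gaussCDF (-x) = 1 := by
  rw [gaussCDF, gaussCDF, ← add_div, gaussInt_add_neg, div_self sqrt_two_pi_pos.ne']

lemma gaussCDF_lt_one (x : ℝ) : gaussCDF x < 1 := by
  linarith [gaussCDF_add_neg x, gaussCDF_pos (-x)]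

lemma gaussCDF_mono : Monotone gaussCDF := by
  refine monotone_of_deriv_nonneg
    (fun x => ((hasDerivAt_gaussInt x).div_const _).differentiableAt) fun x => ?_
  have := ((hasDerivAt_gaussInt x).div_const (√(2 * Real.pi))).deriv
  change 0 ≤ deriv (fun x => gaussInt x / √(2 * Real.pi)) x
  rw [this]; positivity

/-- The reflection identity `(1 - Φ(x)) A(x) = Φ(x) A(-x)`, where `A` is the Mills ratio. -/
lemma gaussCDF_mul_mills (x : ℝ) : gaussCDF (-x) * mills x = gaussCDF x * mills (-x) := by
  simp only [gaussCDF, mills, neg_sq]; ring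

/-! ### The Gaussian Stein equation -/

/-- The solution of the Stein equation `f' - w f = 1{w ≤ z} - Φ(z)` on the half line `w ≤ z`. -/
noncomputable def steinLeft (z w : ℝ) : ℝ := gaussCDF (-z) * mills w

/-- The bounded solution of the Stein equation `f' - w f = 1{w ≤ z} - Φ(z)`. On `w > z` it is the
reflection of the solution for `-z`. -/
noncomputable def steinSol (z w : ℝ) : ℝ :=
  if w ≤ z then steinLeft z w else steinLeft (-z) (-w)

/-- The right-hand side `w f + 1{w ≤ z} - Φ(z)` of the Stein equation, which is `f'` off `z`. -/
noncomputable def steinDeriv (z w : ℝ) : ℝ :=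
  w * steinSol z w + (if w ≤ z then 1 else 0) - gaussCDF z

lemma steinLeft_nonneg (z w : ℝ) : 0 ≤ steinLeft z w :=
  mul_nonneg (gaussCDF_pos _).le (mills_pos _).le

lemma steinLeft_le_two {z w : ℝ} (h : w ≤ z) : steinLeft z w ≤ 2 := by
  have hm := mills_pos w
  rcases le_total w 0 with hw | hw
  · have h1 := mills_neg_le_two (x := -w) (by linarith)
    rw [neg_neg] at h1
    have h2 := gaussCDF_lt_one (-z)
    have h3 := gaussCDF_pos (-z)
    unfold steinLeft; nlinarith
  · have h1 := mills_neg_le_two hw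
    have h2 := gaussCDF_mono (neg_le_neg h)
    have h3 := gaussCDF_mul_mills w
    have h4 := gaussCDF_pos w
    have h5 := gaussCDF_lt_one w
    have h6 : gaussCDF (-z) * mills w ≤ gaussCDF (-w) * mills w := by gcongr
    have h7 := mills_pos (-w)
    unfold steinLeft; nlinarith

lemma steinLeft_deriv_mem {z w : ℝ} (h : w ≤ z) :
    0 ≤ w * steinLeft z w + gaussCDF (-z) ∧ w * steinLeft z w + gaussCDF (-z) ≤ 1 := by
  have he : w * steinLeft z w + gaussCDF (-z) = gaussCDF (-z) * (1 + w * mills w) := by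
    unfold steinLeft; ring
  have hm := mills_pos w
  have h2 := gaussCDF_lt_one (-z)
  have h3 := gaussCDF_pos (-z)
  rw [he]
  rcases le_total w 0 with hw | hw
  · have h1 := mul_mills_neg_le_one (x := -w) (by linarith)
    rw [neg_neg] at h1
    have h4 : 0 ≤ 1 + w * mills w := by linarith
    have h5 : 1 + w * mills w ≤ 1 := by nlinarith
    exact ⟨by positivity, by nlinarith⟩
  · have h1 := mul_mills_neg_le_one hw
    have h5 := gaussCDF_mono (neg_le_neg h)
    have h6 := gaussCDF_mul_mills w
    have h7 : gaussCDF (-z) * (1 + w * mills w) ≤ gaussCDF (-w) * (1 + w * mills w) := by gcongr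
    have h8 := gaussCDF_add_neg w
    have h9 : w * (gaussCDF (-w) * mills w) ≤ gaussCDF w := by
      rw [h6]
      have := gaussCDF_pos w
      nlinarith
    exact ⟨by positivity, by nlinarith⟩

lemma hasDerivAt_steinLeft (z w : ℝ) :
    HasDerivAt (steinLeft z) (w * steinLeft z w + gaussCDF (-z)) w := by
  refine ((hasDerivAt_mills w).const_mul (gaussCDF (-z))).congr_deriv ?_
  unfold steinLeft; ring

lemma abs_steinLeft_sub_le {z v w : ℝ} (hv : v ≤ z) (hw : w ≤ z) :
    |steinLeft z v - steinLeft z w| ≤ |v - w| := by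
  have := (convex_Iic z).norm_image_sub_le_of_norm_hasDerivWithin_le (C := 1)
    (fun x _ => (hasDerivAt_steinLeft z x).hasDerivWithinAt)
    (fun x hx => by
      have := steinLeft_deriv_mem (Set.mem_Iic.1 hx)
      rw [Real.norm_eq_abs, abs_le]; constructor <;> linarith [this.1, this.2])
    (Set.mem_Iic.2 hw) (Set.mem_Iic.2 hv)
  simpa using this

lemma abs_steinLeft_taylor_le {z v w : ℝ} (hv : v ≤ z) (hw : w ≤ z) :
    |steinLeft z v - steinLeft z w - (v - w) * (w * steinLeft z w + gaussCDF (-z))| ≤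
      (v - w) ^ 2 * (2 + |w|) := by
  set c := w * steinLeft z w + gaussCDF (-z) with hc
  have hbound : ∀ x ∈ Set.uIcc w v, ‖x * steinLeft z x + gaussCDF (-z) - c‖ ≤
      |v - w| * (2 + |w|) := by
    intro x hx
    have hxz : x ≤ z := (Set.mem_uIcc.1 hx).elim (fun h => h.2.trans hv) (fun h => h.2.trans hw)
    have h1 : |x - w| ≤ |v - w| := Set.abs_sub_left_of_mem_uIcc hx
    have h2 := abs_steinLeft_sub_le hxz hw
    have h3 : |steinLeft z x| ≤ 2 := by
      rw [abs_of_nonneg (steinLeft_nonneg _ _)]; exact steinLeft_le_two hxz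
    have h4 : x * steinLeft z x + gaussCDF (-z) - c =
        (x - w) * steinLeft z x + w * (steinLeft z x - steinLeft z w) := by rw [hc]; ring
    rw [Real.norm_eq_abs, h4]
    refine (abs_add_le _ _).trans ?_
    rw [abs_mul, abs_mul]
    calc |x - w| * |steinLeft z x| + |w| * |steinLeft z x - steinLeft z w|
        ≤ |v - w| * 2 + |w| * |v - w| :=
          add_le_add (mul_le_mul h1 h3 (abs_nonneg _) (abs_nonneg _))
            (mul_le_mul_of_nonneg_left (h2.trans h1) (abs_nonneg _))
      _ = |v - w| * (2 + |w|) := by ring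
  have := (convex_uIcc w v).norm_image_sub_le_of_norm_hasDerivWithin_le
    (f := fun x => steinLeft z x - x * c)
    (f' := fun x => x * steinLeft z x + gaussCDF (-z) - c)
    (fun x _ => ((hasDerivAt_steinLeft z x).sub
      ((hasDerivAt_id x).mul_const c)).hasDerivWithinAt.congr_deriv (by simp))
    hbound Set.left_mem_uIcc Set.right_mem_uIcc
  rw [Real.norm_eq_abs, Real.norm_eq_abs] at this
  calc _ = |steinLeft z v - v * c - (steinLeft z w - w * c)| := by congr 1; ring
    _ ≤ _ := this
    _ = |v - w| ^ 2 * (2 + |w|) := by ring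
    _ = _ := by rw [sq_abs]

lemma steinSol_of_le {z w : ℝ} (h : w ≤ z) : steinSol z w = steinLeft z w := if_pos h

lemma steinSol_of_ge {z w : ℝ} (h : z ≤ w) : steinSol z w = steinLeft (-z) (-w) := by
  rcases h.eq_or_lt with rfl | h
  · rw [steinSol_of_le le_rfl, steinLeft, steinLeft, neg_neg, gaussCDF_mul_mills]
  · exact if_neg (not_le.2 h)

lemma abs_steinSol_le (z w : ℝ) : |steinSol z w| ≤ 2 := by
  rcases le_total w z with h | h
  · rw [steinSol_of_le h, abs_of_nonneg (steinLeft_nonneg _ _)]; exact steinLeft_le_two h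
  · rw [steinSol_of_ge h, abs_of_nonneg (steinLeft_nonneg _ _)]
    exact steinLeft_le_two (neg_le_neg h)

lemma steinDeriv_of_le {z w : ℝ} (h : w ≤ z) :
    steinDeriv z w = w * steinLeft z w + gaussCDF (-z) := by
  rw [steinDeriv, if_pos h, steinSol_of_le h]; linarith [gaussCDF_add_neg z]

lemma steinDeriv_of_gt {z w : ℝ} (h : z < w) :
    steinDeriv z w = -((-w) * steinLeft (-z) (-w) + gaussCDF (- -z)) := by
  rw [steinDeriv, if_neg (not_le.2 h), steinSol_of_ge h.le, neg_neg]; ring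

lemma abs_steinDeriv_le (z w : ℝ) : |steinDeriv z w| ≤ 1 := by
  rcases le_or_gt w z with h | h
  · have := steinLeft_deriv_mem h
    rw [steinDeriv_of_le h, abs_of_nonneg this.1]; exact this.2
  · have := steinLeft_deriv_mem (neg_le_neg h.le)
    rw [steinDeriv_of_gt h, abs_neg, abs_of_nonneg this.1]; exact this.2

lemma abs_steinSol_sub_le (z v w : ℝ) : |steinSol z v - steinSol z w| ≤ |v - w| := by
  wlog hvw : w ≤ v generalizing v w
  · rw [abs_sub_comm, abs_sub_comm v]; exact this w v (le_of_not_ge hvw)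
  have hright : ∀ {v w : ℝ}, z ≤ v → z ≤ w → |steinSol z v - steinSol z w| ≤ |v - w| := by
    intro v w hv hw
    rw [steinSol_of_ge hv, steinSol_of_ge hw]
    refine (abs_steinLeft_sub_le (neg_le_neg hv) (neg_le_neg hw)).trans_eq ?_
    rw [← abs_neg]; congr 1; ring
  rcases le_total v z with hv | hv
  · rw [steinSol_of_le hv, steinSol_of_le (hvw.trans hv)]
    exact abs_steinLeft_sub_le hv (hvw.trans hv)
  rcases le_total w z with hw | hw
  · have h1 := hright hv le_rfl
    have h2 := abs_steinLeft_sub_le le_rfl hw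
    rw [← steinSol_of_le le_rfl, ← steinSol_of_le hw] at h2
    rw [abs_of_nonneg (sub_nonneg.2 hv)] at h1
    rw [abs_of_nonneg (sub_nonneg.2 hw)] at h2
    rw [abs_of_nonneg (sub_nonneg.2 hvw)]
    have := abs_sub_le (steinSol z v) (steinSol z z) (steinSol z w)
    linarith
  · exact hright hv hw

/-- First-order Taylor expansion of the Stein solution: the derivative is Lipschitz on each side of
its jump at `z`, so an increment that does not cross `z` costs a quadratic error only. -/
lemma abs_steinSol_taylor_le (z w u : ℝ) :
    |steinSol z (w + u) - steinSol z w - u * steinDeriv z w| ≤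
      u ^ 2 * (2 + |w|) + 2 * |u| * (if |w - z| ≤ |u| then 1 else 0) := by
  by_cases hcross : |w - z| ≤ |u|
  · rw [if_pos hcross]
    have h1 := abs_steinSol_sub_le z (w + u) w
    rw [add_sub_cancel_left] at h1
    have h2 : |u * steinDeriv z w| ≤ |u| := by
      rw [abs_mul]; exact mul_le_of_le_one_right (abs_nonneg _) (abs_steinDeriv_le z w)
    have h3 := abs_sub (steinSol z (w + u) - steinSol z w) (u * steinDeriv z w)
    have h4 : 0 ≤ u ^ 2 * (2 + |w|) := by positivity
    linarith
  · rw [if_neg hcross, mul_zero, add_zero]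
    rw [not_le] at hcross
    rcases le_or_gt w z with hw | hw
    · have hv : w + u ≤ z := by
        rw [abs_of_nonpos (sub_nonpos.2 hw)] at hcross
        linarith [le_abs_self u]
      rw [steinDeriv_of_le hw, steinSol_of_le hw, steinSol_of_le hv]
      have := abs_steinLeft_taylor_le hv hw
      rwa [add_sub_cancel_left] at this
    · have hv : z ≤ w + u := by
        rw [abs_of_pos (sub_pos.2 hw)] at hcross
        linarith [neg_abs_le u]
      rw [steinDeriv_of_gt hw, steinSol_of_ge hw.le, steinSol_of_ge hv]
      have := abs_steinLeft_taylor_le (neg_le_neg hv) (neg_le_neg hw.le)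
      rw [show -(w + u) - -w = -u by ring, neg_sq, abs_neg] at this
      convert this using 2
      ring

/-! ### The Berry-Esseen bound for weighted sums of independent Poisson variables -/

/-- The law of independent Poisson variables with rates `r`. -/
noncomputable abbrev poissonPi {d : ℕ} (r : Fin d → ℝ≥0) : Measure (Fin d → ℕ) :=
  Measure.pi fun j => poissonMeasure (r j)

/-- The centered linear statistic `∑ j, u j * (x j - r j)` of the counts `x`. -/
noncomputable def centeredSum {d : ℕ} (r : Fin d → ℝ≥0) (u : Fin d → ℝ) (x : Fin d → ℕ) : ℝ :=
  ∑ j, u j * ((x j : ℝ) - r j)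

section Mecke

variable {d : ℕ} (r : Fin d → ℝ≥0) (u : Fin d → ℝ)

lemma natCast_mul_poissonMeasure_singleton_succ (r : ℝ≥0) (n : ℕ) :
    ((n + 1 : ℕ) : ENNReal) * poissonMeasure r {n + 1} = r * poissonMeasure r {n} := by
  rw [poissonMeasure_singleton, poissonMeasure_singleton, ← ENNReal.ofReal_natCast,
    ← ENNReal.ofReal_coe_nnreal, ← ENNReal.ofReal_mul (by positivity),
    ← ENNReal.ofReal_mul (by positivity)]
  congr 1
  rw [Nat.factorial_succ]
  push_cast
  field_simp
  ring

/-- The Mecke formula: weighting a Poisson law by the `j`-th count amounts to adding a point in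
coordinate `j` and multiplying by the rate. -/
lemma withDensity_poissonPi (j : Fin d) :
    (poissonPi r).withDensity (fun x => ((x j : ℝ≥0) : ENNReal)) =
      r j • (poissonPi r).map (fun x => x + Pi.single j 1) := by
  refine Measure.ext_of_singleton fun y => ?_
  rw [withDensity_apply _ (measurableSet_singleton y), Measure.smul_apply,
    Measure.map_apply .of_discrete (measurableSet_singleton y), lintegral_singleton]
  rcases Nat.eq_zero_or_pos (y j) with h0 | hpos
  · have : (fun x : Fin d → ℕ => x + Pi.single j 1) ⁻¹' {y} = ∅ := by
      ext x
      simp only [Set.mem_preimage, Set.mem_singleton_iff, Set.mem_empty_iff_false, iff_false]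
      intro h
      have := congrFun h j
      simp [h0] at this
    simp [this, h0]
  · obtain ⟨x, rfl⟩ : ∃ x : Fin d → ℕ, y = x + Pi.single j 1 := by
      refine ⟨y - Pi.single j 1, funext fun k => ?_⟩
      rcases eq_or_ne k j with rfl | hk
      · simp; omega
      · simp [hk]
    have : (fun x : Fin d → ℕ => x + Pi.single j 1) ⁻¹' {x + Pi.single j 1} = {x} := by
      ext x'; simp
    rw [this, Measure.pi_singleton, Measure.pi_singleton,
      ← Finset.mul_prod_erase _ _ (Finset.mem_univ j),
      ← Finset.mul_prod_erase _ _ (Finset.mem_univ j)]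
    have hrest : ∏ k ∈ Finset.univ.erase j, poissonMeasure (r k) {(x + Pi.single j 1 : Fin d → ℕ) k}
        = ∏ k ∈ Finset.univ.erase j, poissonMeasure (r k) {x k} := by
      refine Finset.prod_congr rfl fun k hk => ?_
      simp [Finset.ne_of_mem_erase hk]
    rw [hrest, ← mul_assoc]
    have hj := natCast_mul_poissonMeasure_singleton_succ (r j) (x j)
    have hval : (x + Pi.single j 1 : Fin d → ℕ) j = x j + 1 := by simp
    rw [hval]
    have hc : (((x j + 1 : ℕ) : ℝ≥0) : ENNReal) = ((x j + 1 : ℕ) : ENNReal) := by simp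
    rw [hc, hj, mul_assoc, ENNReal.smul_def, smul_eq_mul]

variable {r}

lemma integrable_count_mul {g : (Fin d → ℕ) → ℝ} (j : Fin d)
    (hg : Integrable (fun x => g (x + Pi.single j 1)) (poissonPi r)) :
    Integrable (fun x => (x j : ℝ) * g x) (poissonPi r) := by
  have h : Integrable g ((poissonPi r).withDensity (fun x => ((x j : ℝ≥0) : ENNReal))) := by
    rw [withDensity_poissonPi]
    refine Integrable.smul_measure_nnreal ?_
    rwa [integrable_map_measure .of_discrete .of_discrete]
  rw [integrable_withDensity_iff_integrable_coe_smul .of_discrete] at h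
  simpa using h

lemma integral_count_mul {g : (Fin d → ℕ) → ℝ} (j : Fin d) :
    ∫ x, (x j : ℝ) * g x ∂(poissonPi r) =
      r j * ∫ x, g (x + Pi.single j 1) ∂(poissonPi r) := by
  have h := integral_withDensity_eq_integral_smul (μ := poissonPi r)
    (f := fun x => (x j : ℝ≥0)) .of_discrete g
  rw [withDensity_poissonPi, integral_smul_nnreal_measure,
    integral_map .of_discrete .of_discrete] at h
  simpa [NNReal.smul_def] using h.symm

variable (r)

lemma centeredSum_add_single (x : Fin d → ℕ) (j : Fin d) :
    centeredSum r u (x + Pi.single j 1) = centeredSum r u x + u j := by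
  have : ∀ k, u k * ((((x + Pi.single j 1 : Fin d → ℕ) k : ℕ) : ℝ) - r k) =
      u k * ((x k : ℝ) - r k) + (if k = j then u j else 0) := by
    intro k
    rcases eq_or_ne k j with rfl | hk
    · simp; ring
    · simp [hk]
  simp only [centeredSum, this, Finset.sum_add_distrib]
  simp

lemma integrable_count (j : Fin d) : Integrable (fun x => (x j : ℝ)) (poissonPi r) := by
  simpa using integrable_count_mul (r := r) (g := fun _ => 1) j (integrable_const _)

lemma integrable_centeredSum : Integrable (centeredSum r u) (poissonPi r) :=
  integrable_finsetSum _ fun j _ =>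
    ((integrable_count r j).sub (integrable_const _)).const_mul _

/-- Stein's identity for Poisson sums, by the Mecke formula in each coordinate. -/
lemma integral_centeredSum_mul {g : ℝ → ℝ}
    (hg : Integrable (fun x => g (centeredSum r u x)) (poissonPi r))
    (hgu : ∀ j, Integrable (fun x => g (centeredSum r u x + u j)) (poissonPi r)) :
    Integrable (fun x => centeredSum r u x * g (centeredSum r u x)) (poissonPi r) ∧
    ∫ x, centeredSum r u x * g (centeredSum r u x) ∂(poissonPi r) =
      ∑ j, r j * u j *
        ∫ x, (g (centeredSum r u x + u j) - g (centeredSum r u x)) ∂(poissonPi r) := by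
  have hcount : ∀ j, Integrable (fun x => (x j : ℝ) * g (centeredSum r u x)) (poissonPi r) := by
    intro j
    refine integrable_count_mul (r := r) j ?_
    simp only [centeredSum_add_single]
    exact hgu j
  have hterm : ∀ j, Integrable (fun x => u j * ((x j : ℝ) * g (centeredSum r u x) -
      r j * g (centeredSum r u x))) (poissonPi r) :=
    fun j => ((hcount j).sub (hg.const_mul _)).const_mul _
  have hexp : (fun x => centeredSum r u x * g (centeredSum r u x)) = fun x => ∑ j, u j *
      ((x j : ℝ) * g (centeredSum r u x) - r j * g (centeredSum r u x)) := by
    funext x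
    conv_lhs => rw [centeredSum, Finset.sum_mul]
    refine Finset.sum_congr rfl fun j _ => ?_
    rw [centeredSum]; ring
  rw [hexp]
  refine ⟨integrable_finsetSum _ fun j _ => hterm j, ?_⟩
  rw [integral_finsetSum _ fun j _ => hterm j]
  refine Finset.sum_congr rfl fun j _ => ?_
  rw [integral_const_mul, integral_sub (hcount j) (hg.const_mul _), integral_const_mul,
    integral_count_mul, integral_sub (hgu j) hg]
  simp only [centeredSum_add_single]
  ring

variable {u}

lemma integral_centeredSum_sq (hvar : ∑ j, (r j : ℝ) * u j ^ 2 = 1) :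
    Integrable (fun x => centeredSum r u x ^ 2) (poissonPi r) ∧
      ∫ x, centeredSum r u x ^ 2 ∂(poissonPi r) = 1 := by
  have h := integral_centeredSum_mul r u (g := id) (integrable_centeredSum r u)
    (fun j => (integrable_centeredSum r u).add (integrable_const _))
  simp only [id, ← sq, add_sub_cancel_left] at h
  refine ⟨h.1, h.2.trans ?_⟩
  rw [← hvar]
  refine Finset.sum_congr rfl fun j _ => ?_
  simp; ring

lemma integral_abs_centeredSum_le (hvar : ∑ j, (r j : ℝ) * u j ^ 2 = 1) :
    ∫ x, |centeredSum r u x| ∂(poissonPi r) ≤ 1 := by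
  obtain ⟨h1, h2⟩ := integral_centeredSum_sq r hvar
  calc ∫ x, |centeredSum r u x| ∂(poissonPi r)
      ≤ ∫ x, (1 + centeredSum r u x ^ 2) / 2 ∂(poissonPi r) := by
        refine integral_mono (integrable_centeredSum r u).abs
          (((integrable_const _).add h1).div_const _) fun x => ?_
        have := sq_nonneg (|centeredSum r u x| - 1)
        rw [sub_sq, sq_abs] at this
        simp only []
        linarith
    _ = 1 := by
        rw [integral_div, integral_add (integrable_const _) h1, h2]; simp

/-- Concentration: the standardized sum puts mass at most `(b - a) / 2 + γ` on `[a, b]`, by Stein's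
identity for a function that has slope one on the `γ`-neighbourhood of `[a, b]` and is constant
elsewhere. -/
lemma measureReal_centeredSum_mem_Icc_le (hvar : ∑ j, (r j : ℝ) * u j ^ 2 = 1) {γ : ℝ}
    (hγ : ∀ j, |u j| ≤ γ) (hγ0 : 0 ≤ γ) {a b : ℝ} (hab : a ≤ b) :
    (poissonPi r).real {x | centeredSum r u x ∈ Set.Icc a b} ≤ (b - a) / 2 + γ := by
  set h : ℝ := (b - a) / 2 + γ with hh
  have hh0 : 0 ≤ h := by rw [hh]; linarith
  set g : ℝ → ℝ := fun w => max (-h) (min h (w - (a + b) / 2)) with hg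
  have hgb : ∀ w, |g w| ≤ h := fun w =>
    abs_le.2 ⟨le_max_left _ _, max_le (by linarith) (min_le_left _ _)⟩
  have hgm : Monotone g := fun v w hvw =>
    max_le_max le_rfl (min_le_min le_rfl (by linarith))
  have hgi : ∀ v : ℝ, Integrable (fun x => g (centeredSum r u x + v)) (poissonPi r) := fun v =>
    Integrable.of_bound .of_discrete h (ae_of_all _ fun x => hgb _)
  have hgi0 : Integrable (fun x => g (centeredSum r u x)) (poissonPi r) := by
    simpa using hgi 0
  obtain ⟨hI, hE⟩ := integral_centeredSum_mul r u hgi0 fun j => hgi (u j)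
  have hup : ∫ x, centeredSum r u x * g (centeredSum r u x) ∂(poissonPi r) ≤ h := by
    calc _ ≤ ∫ x, |centeredSum r u x| * h ∂(poissonPi r) := by
          refine integral_mono hI ((integrable_centeredSum r u).abs.mul_const _) fun x => ?_
          refine (le_abs_self _).trans ?_
          rw [abs_mul]
          exact mul_le_mul_of_nonneg_left (hgb _) (abs_nonneg _)
      _ = (∫ x, |centeredSum r u x| ∂(poissonPi r)) * h := integral_mul_const _ _
      _ ≤ h := mul_le_of_le_one_left hh0 (integral_abs_centeredSum_le r hvar)
  set E : Set (Fin d → ℕ) := {x | centeredSum r u x ∈ Set.Icc a b} with hEdef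
  have hpt : ∀ j x, u j ^ 2 * E.indicator 1 x ≤
      u j * (g (centeredSum r u x + u j) - g (centeredSum r u x)) := by
    intro j x
    have hj := abs_le.1 (hγ j)
    by_cases hx : x ∈ E
    · have hlin : ∀ w, a - γ ≤ w → w ≤ b + γ → g w = w - (a + b) / 2 := by
        intro w h1 h2
        simp only [hg]
        rw [min_eq_right (by rw [hh]; linarith), max_eq_right (by rw [hh]; linarith)]
      rw [hlin _ (by linarith [hx.1]) (by linarith [hx.2]),
        hlin _ (by linarith [hx.1]) (by linarith [hx.2])]
      simp [hx]; nlinarith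
    · simp only [Set.indicator_of_notMem hx, mul_zero]
      rcases le_total 0 (u j) with h0 | h0
      · exact mul_nonneg h0 (sub_nonneg.2 (hgm (by linarith)))
      · exact mul_nonneg_of_nonpos_of_nonpos h0 (sub_nonpos.2 (hgm (by linarith)))
  have hlow : (poissonPi r).real E ≤
      ∫ x, centeredSum r u x * g (centeredSum r u x) ∂(poissonPi r) := by
    rw [hE, ← one_mul ((poissonPi r).real E), ← hvar, Finset.sum_mul]
    refine Finset.sum_le_sum fun j _ => ?_
    rw [mul_assoc, mul_assoc]
    refine mul_le_mul_of_nonneg_left ?_ (r j).2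
    rw [← integral_const_mul, ← integral_indicator_one .of_discrete, ← integral_const_mul]
    exact integral_mono
      (((integrable_const 1).indicator .of_discrete).const_mul _)
      (((hgi (u j)).sub hgi0).const_mul _) (hpt j)
  exact hlow.trans hup

/-- The Berry-Esseen bound: the distribution function of a standardized weighted sum of independent
Poisson variables is within `7 γ` of the Gaussian one if no weight exceeds `γ`. The smooth part of
the Taylor error of the Stein solution contributes `3 γ`, its jump `4 γ`. -/
theorem abs_measureReal_centeredSum_le_sub_gaussCDF (hvar : ∑ j, (r j : ℝ) * u j ^ 2 = 1) {γ : ℝ}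
    (hγ : ∀ j, |u j| ≤ γ) (hγ0 : 0 ≤ γ) (z : ℝ) :
    |(poissonPi r).real {x | centeredSum r u x ≤ z} - gaussCDF z| ≤ 7 * γ := by
  have hfi : ∀ v : ℝ, Integrable (fun x => steinSol z (centeredSum r u x + v)) (poissonPi r) :=
    fun v => Integrable.of_bound .of_discrete 2 (ae_of_all _ fun x => abs_steinSol_le _ _)
  have hfi0 : Integrable (fun x => steinSol z (centeredSum r u x)) (poissonPi r) := by
    simpa using hfi 0
  have hdi : Integrable (fun x => steinDeriv z (centeredSum r u x)) (poissonPi r) :=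
    Integrable.of_bound .of_discrete 1 (ae_of_all _ fun x => abs_steinDeriv_le _ _)
  obtain ⟨hI, hE⟩ := integral_centeredSum_mul r u hfi0 fun j => hfi (u j)
  have hind : Integrable ({x | centeredSum r u x ≤ z}.indicator (1 : (Fin d → ℕ) → ℝ))
      (poissonPi r) := (integrable_const 1).indicator .of_discrete
  have hD : ∫ x, steinDeriv z (centeredSum r u x) ∂(poissonPi r) =
      ∫ x, centeredSum r u x * steinSol z (centeredSum r u x) ∂(poissonPi r) +
        ((poissonPi r).real {x | centeredSum r u x ≤ z} - gaussCDF z) := by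
    have : (fun x => steinDeriv z (centeredSum r u x)) = fun x =>
        centeredSum r u x * steinSol z (centeredSum r u x) +
          ({x | centeredSum r u x ≤ z}.indicator 1 x - gaussCDF z) := by
      funext x
      simp only [steinDeriv, Set.indicator_apply, Set.mem_ofPred_eq, Pi.one_apply]; ring
    have hind' : Integrable (fun x => {x | centeredSum r u x ≤ z}.indicator
        (1 : (Fin d → ℕ) → ℝ) x - gaussCDF z) (poissonPi r) := hind.sub (integrable_const _)
    rw [this, integral_add hI hind',
      integral_sub hind (integrable_const _), integral_indicator_one .of_discrete]
    simp
  have hdiff : (poissonPi r).real {x | centeredSum r u x ≤ z} - gaussCDF z =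
      -∑ j, r j * u j * ∫ x, (steinSol z (centeredSum r u x + u j) - steinSol z (centeredSum r u x)
        - u j * steinDeriv z (centeredSum r u x)) ∂(poissonPi r) := by
    have h1 : ∀ j, (r j : ℝ) * u j * ∫ x, (steinSol z (centeredSum r u x + u j) -
        steinSol z (centeredSum r u x) - u j * steinDeriv z (centeredSum r u x)) ∂(poissonPi r) =
        r j * u j * (∫ x, (steinSol z (centeredSum r u x + u j) -
          steinSol z (centeredSum r u x)) ∂(poissonPi r)) -
        r j * u j ^ 2 * ∫ x, steinDeriv z (centeredSum r u x) ∂(poissonPi r) := by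
      intro j
      have hdf : Integrable (fun x => steinSol z (centeredSum r u x + u j) -
          steinSol z (centeredSum r u x)) (poissonPi r) := (hfi (u j)).sub hfi0
      rw [integral_sub hdf (hdi.const_mul _), integral_const_mul]
      ring
    rw [Finset.sum_congr rfl fun j _ => h1 j, Finset.sum_sub_distrib, ← hE, ← Finset.sum_mul, hvar]
    linarith
  set E : Set (Fin d → ℕ) := {x | centeredSum r u x ∈ Set.Icc (z - γ) (z + γ)} with hEdef
  have hEle : (poissonPi r).real E ≤ 2 * γ := by
    refine (measureReal_centeredSum_mem_Icc_le r hvar hγ hγ0 (by linarith)).trans_eq ?_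
    ring
  have hindE : Integrable (E.indicator (1 : (Fin d → ℕ) → ℝ)) (poissonPi r) :=
    (integrable_const 1).indicator .of_discrete
  have hterm : ∀ j, |∫ x, (steinSol z (centeredSum r u x + u j) - steinSol z (centeredSum r u x)
        - u j * steinDeriv z (centeredSum r u x)) ∂(poissonPi r)| ≤ |u j| * (7 * γ) := by
    intro j
    have habs := (integrable_centeredSum r u).abs
    calc _ ≤ ∫ x, (u j ^ 2 * (2 + |centeredSum r u x|) + 2 * |u j| * E.indicator 1 x)
          ∂(poissonPi r) := by
          refine (abs_integral_le_integral_abs).trans (integral_mono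
            ((((hfi (u j)).sub hfi0).sub (hdi.const_mul _)).abs)
            ((((integrable_const 2).add habs).const_mul _).add (hindE.const_mul _)) fun x => ?_)
          refine (abs_steinSol_taylor_le _ _ _).trans ?_
          gcongr
          split_ifs with hx
          · have hx' := abs_le.1 (hx.trans (hγ j))
            have : x ∈ E := ⟨by linarith [hx'.1], by linarith [hx'.2]⟩
            simp [this]
          · exact Set.indicator_nonneg (fun _ _ => zero_le_one) _
      _ = u j ^ 2 * (2 + ∫ x, |centeredSum r u x| ∂(poissonPi r)) +
          2 * |u j| * (poissonPi r).real E := by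
          have h2 : Integrable (fun x => u j ^ 2 * (2 + |centeredSum r u x|)) (poissonPi r) :=
            ((integrable_const 2).add habs).const_mul _
          rw [integral_add h2 (hindE.const_mul _),
            integral_const_mul, integral_const_mul, integral_add (integrable_const 2) habs,
            integral_indicator_one .of_discrete]
          simp
      _ ≤ u j ^ 2 * (2 + 1) + 2 * |u j| * (2 * γ) := by
          have := integral_abs_centeredSum_le r hvar
          gcongr
      _ ≤ |u j| * (7 * γ) := by
          rw [← sq_abs]; nlinarith [hγ j, abs_nonneg (u j)]
  rw [hdiff, abs_neg]
  calc _ ≤ ∑ j, (r j : ℝ) * u j ^ 2 * (7 * γ) := by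
        refine (Finset.abs_sum_le_sum_abs _ _).trans (Finset.sum_le_sum fun j _ => ?_)
        rw [abs_mul, abs_mul, abs_of_nonneg (r j).coe_nonneg, ← sq_abs (u j), mul_assoc, mul_assoc]
        refine mul_le_mul_of_nonneg_left ?_ (r j).2
        calc _ ≤ |u j| * (|u j| * (7 * γ)) :=
              mul_le_mul_of_nonneg_left (hterm j) (abs_nonneg _)
          _ = _ := by ring
    _ = 7 * γ := by rw [← Finset.sum_mul, hvar, one_mul]

end Mecke

/-! ### Thinning of Poisson counts -/

/-- A binomially thinned Poisson variable is Poisson. -/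
lemma integral_binomial_poissonMeasure (r : ℝ≥0) (p : unitInterval) (k : ℕ) :
    ∫ n, (binomial n p).real {k} ∂(poissonMeasure r) =
      (poissonMeasure (unitInterval.toNNReal p * r)).real {k} := by
  rw [integral_poissonMeasure, poissonMeasure_real_singleton]
  have hinj : Function.Injective fun m : ℕ => m + k := fun a b h => by simpa using h
  have hsupp : Function.support (fun n : ℕ => (Real.exp (-r) * r ^ n / (n.factorial : ℝ)) •
      (binomial n p).real {k}) ⊆ Set.range fun m : ℕ => m + k := by
    intro n hn
    by_contra hcon
    have hlt : n < k := by
      by_contra h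
      exact hcon ⟨n - k, by simp; omega⟩
    exact hn (by simp [binomial_real_singleton, Nat.choose_eq_zero_of_lt hlt])
  rw [← hinj.tsum_eq hsupp]
  have hterm : ∀ m : ℕ, (Real.exp (-r) * (r : ℝ) ^ (m + k) / ((m + k).factorial : ℝ)) •
      (binomial (m + k) p).real {k} = Real.exp (-r) * ((p : ℝ) * r) ^ k / (k.factorial : ℝ) *
        (((1 - p : ℝ) * r) ^ m / (m.factorial : ℝ)) := by
    intro m
    have hchoose : ((m + k).choose k : ℝ) =
        ((m + k).factorial : ℝ) / ((m.factorial : ℝ) * (k.factorial : ℝ)) := by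
      rw [Nat.cast_choose ℝ (Nat.le_add_left k m), Nat.add_sub_cancel]
      ring
    rw [binomial_real_singleton, hchoose, Nat.add_sub_cancel, smul_eq_mul, mul_pow, mul_pow,
      pow_add]
    have hf : ((m + k).factorial : ℝ) ≠ 0 := by positivity
    field_simp
  simp only [hterm]
  rw [tsum_mul_left, (NormedSpace.expSeries_div_hasSum_exp ((1 - p : ℝ) * r)).tsum_eq,
    ← Real.exp_eq_exp_ℝ]
  have he : Real.exp (-r) * Real.exp ((1 - p : ℝ) * r) = Real.exp (-(p * r)) := by
    rw [← Real.exp_add]; congr 1; ring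
  have hp : ((unitInterval.toNNReal p * r : ℝ≥0) : ℝ) = p * r := by simp
  rw [hp, ← he]
  ring

/-- Dropout turns independent Poisson counts into independent Poisson counts with the rates scaled
by `1 - δ`. -/
lemma poissonPi_bind_thinLaw {d : ℕ} (δ : unitInterval) (r : Fin d → ℝ≥0) :
    (poissonPi r).toPMF.bind (thinLaw δ) =
      (poissonPi fun j => unitInterval.toNNReal (unitInterval.symm δ) * r j).toPMF := by
  refine PMF.ext fun y => ?_
  rw [PMF.bind_apply, Measure.toPMF_apply]
  have h1 : ∀ x : Fin d → ℕ, thinLaw δ x y = ENNReal.ofReal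
      (∏ j, (binomial (x j) (unitInterval.symm δ)).real {y j}) := by
    intro x
    rw [thinLaw, Measure.toPMF_apply, Measure.pi_singleton,
      ENNReal.ofReal_prod_of_nonneg fun j _ => measureReal_nonneg]
    simp
  have h2 : ∀ x, (poissonPi r).toPMF x * thinLaw δ x y =
      thinLaw δ x y * poissonPi r {x} := fun x => by rw [mul_comm, Measure.toPMF_apply]
  simp only [h2]
  rw [← lintegral_countable' (fun x => thinLaw δ x y)]
  simp only [h1]
  rw [← ofReal_integral_eq_lintegral_ofReal
    (Integrable.of_bound .of_discrete 1 (ae_of_all _ fun x => ?_))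
    (ae_of_all _ fun x => Finset.prod_nonneg fun j _ => measureReal_nonneg)]
  · rw [integral_fintype_prod_eq_prod
      (f := fun j (n : ℕ) => (binomial n (unitInterval.symm δ)).real {y j}), Measure.pi_singleton]
    simp only [integral_binomial_poissonMeasure]
    rw [ENNReal.ofReal_prod_of_nonneg fun j _ => measureReal_nonneg]
    simp
  · rw [Real.norm_eq_abs, abs_of_nonneg (Finset.prod_nonneg fun j _ => measureReal_nonneg)]
    exact Finset.prod_le_one (fun j _ => measureReal_nonneg) fun j _ => measureReal_le_one

/-! ### Error probabilities of a linear rule under a single topic -/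

/-- The mean of `∑ j, w j * x j` in units of its standard deviation, when the counts `x j` are
Poisson with rates `r j`. -/
noncomputable def signalToNoise {d : ℕ} (r : Fin d → ℝ≥0) (w : Fin d → ℝ) : ℝ :=
  (∑ j, (r j : ℝ) * w j) / √(∑ j, (r j : ℝ) * w j ^ 2)

/-- The signal-to-noise ratio in favour of the label `c`. -/
noncomputable def signedMargin {d : ℕ} (r : Fin d → ℝ≥0) (w : Fin d → ℝ) (c : Bool) : ℝ :=
  if c then signalToNoise r w else -signalToNoise r w

lemma signedMargin_smul {d : ℕ} (p : ℝ≥0) (r : Fin d → ℝ≥0) (w : Fin d → ℝ) (c : Bool) :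
    signedMargin (fun j => p * r j) w c = √p * signedMargin r w c := by
  have h : signalToNoise (fun j => p * r j) w = √p * signalToNoise r w := by
    simp only [signalToNoise, NNReal.coe_mul, mul_assoc, ← Finset.mul_sum]
    rw [Real.sqrt_mul p.coe_nonneg]
    rcases eq_or_ne p 0 with rfl | hp
    · simp
    · have h0 : 0 < (p : ℝ) := by positivity
      have h1 : √(p : ℝ) ≠ 0 := (Real.sqrt_pos.2 h0).ne'
      rw [mul_div_mul_comm]
      congr 1
      rw [div_eq_iff h1, Real.mul_self_sqrt h0.le]
  cases c <;> simp [signedMargin, h]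

lemma linearRule_eq_false_iff {d : ℕ} (r : Fin d → ℝ≥0) (w : Fin d → ℝ)
    (hv : 0 < ∑ j, (r j : ℝ) * w j ^ 2) (x : Fin d → ℕ) :
    linearRule w x = false ↔
      centeredSum r (fun j => w j / √(∑ j, (r j : ℝ) * w j ^ 2)) x ≤ -signalToNoise r w := by
  have hs : 0 < √(∑ j, (r j : ℝ) * w j ^ 2) := Real.sqrt_pos.2 hv
  have h : centeredSum r (fun j => w j / √(∑ j, (r j : ℝ) * w j ^ 2)) x =
      (∑ j, w j * (x j : ℝ)) / √(∑ j, (r j : ℝ) * w j ^ 2) - signalToNoise r w := by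
    rw [centeredSum, signalToNoise, ← sub_div, ← Finset.sum_sub_distrib, Finset.sum_div]
    exact Finset.sum_congr rfl fun j _ => by ring
  rw [h, linearRule, decide_eq_false_iff_not, not_lt]
  constructor
  · intro h0
    have := div_nonpos_of_nonpos_of_nonneg h0 hs.le
    linarith
  · intro h0
    have h1 : (∑ j, w j * (x j : ℝ)) / √(∑ j, (r j : ℝ) * w j ^ 2) ≤ 0 := by linarith
    rwa [div_le_iff₀ hs, zero_mul] at h1

/-- The normal approximation to the probability of deciding against the label `c`. -/
lemma abs_measureReal_linearRule_ne_sub_le {d : ℕ} (r : Fin d → ℝ≥0) (w : Fin d → ℝ)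
    (hv : 0 < ∑ j, (r j : ℝ) * w j ^ 2) {γ : ℝ} (hγ0 : 0 ≤ γ)
    (hγ : ∀ j, |w j| ≤ γ * √(∑ j, (r j : ℝ) * w j ^ 2)) (c : Bool) :
    |(poissonPi r).real {x | linearRule w x ≠ c} - gaussCDF (-signedMargin r w c)| ≤ 7 * γ := by
  have hs : 0 < √(∑ j, (r j : ℝ) * w j ^ 2) := Real.sqrt_pos.2 hv
  have hvar : ∑ j, (r j : ℝ) * (w j / √(∑ j, (r j : ℝ) * w j ^ 2)) ^ 2 = 1 := by
    simp only [div_pow, Real.sq_sqrt hv.le, ← mul_div_assoc, ← Finset.sum_div]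
    exact div_self hv.ne'
  have hmain := abs_measureReal_centeredSum_le_sub_gaussCDF r hvar (γ := γ)
    (fun j => by rw [abs_div, abs_of_pos hs, div_le_iff₀ hs]; exact hγ j) hγ0
    (-signalToNoise r w)
  simp only [← linearRule_eq_false_iff r w hv] at hmain
  cases c
  · have hset : {x : Fin d → ℕ | linearRule w x ≠ false} = {x | linearRule w x = false}ᶜ := rfl
    rw [hset, probReal_compl_eq_one_sub .of_discrete]
    have := gaussCDF_add_neg (signalToNoise r w)
    simp only [signedMargin, Bool.false_eq_true, if_false, neg_neg]
    rw [← abs_neg]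
    convert hmain using 2
    linarith
  · simpa [signedMargin] using hmain

/-! ### The risk transfer function and Gaussian tails -/

/-- The map `t ↦ t ^ (1 / (1 - δ)) * max 1 (√(-log t) ^ (δ / (1 - δ)))`, which turns an error
probability under dropout into one without. -/
noncomputable def riskTransfer (δ t : ℝ) : ℝ :=
  t ^ (1 / (1 - δ)) * max 1 (√(-Real.log t) ^ (δ / (1 - δ)))

section Transfer

variable {δ : ℝ}

lemma one_div_one_sub_eq (h1 : δ < 1) : 1 / (1 - δ) = 1 + δ / (1 - δ) := by
  have : 1 - δ ≠ 0 := by linarith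
  field_simp
  ring

lemma max_one_rpow_eq {x b : ℝ} (hx : 0 ≤ x) (hb : 0 ≤ b) : max 1 (x ^ b) = (max 1 x) ^ b := by
  rcases le_total x 1 with h | h
  · rw [max_eq_left h, max_eq_left (Real.rpow_le_one hx h hb), Real.one_rpow]
  · rw [max_eq_right h, max_eq_right (Real.one_le_rpow h hb)]

lemma riskTransfer_eq (h0 : 0 < δ) (h1 : δ < 1) {t : ℝ} (ht : 0 ≤ t) :
    riskTransfer δ t = t * (t * max 1 √(-Real.log t)) ^ (δ / (1 - δ)) := by
  have hb : 0 < δ / (1 - δ) := div_pos h0 (by linarith)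
  rw [riskTransfer, max_one_rpow_eq (Real.sqrt_nonneg _) hb.le, one_div_one_sub_eq h1,
    Real.mul_rpow ht (by positivity), Real.rpow_add_of_nonneg ht zero_le_one hb.le,
    Real.rpow_one]
  ring

lemma riskTransfer_nonneg {t : ℝ} (ht : 0 ≤ t) : 0 ≤ riskTransfer δ t :=
  mul_nonneg (Real.rpow_nonneg ht _) (by positivity)

lemma mul_max_one_sqrt_neg_log_mono {t t' : ℝ} (ht : 0 ≤ t) (h : t ≤ t') :
    t * max 1 √(-Real.log t) ≤ t' * max 1 √(-Real.log t') := by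
  rcases ht.eq_or_lt with rfl | ht
  · rw [zero_mul]; positivity
  have ht' : 0 < t' := ht.trans_le h
  set m := max 1 √(-Real.log t') with hm
  have hm1 : 1 ≤ m := le_max_left _ _
  have hx1 : 1 ≤ t' / t := (one_le_div ht).2 h
  have hlog : -Real.log t ≤ m ^ 2 * (t' / t) ^ 2 := by
    have h2 : -Real.log t' ≤ m ^ 2 := (Real.sqrt_le_left (by linarith)).1 (le_max_right _ _)
    have h3 : Real.log (t' / t) ≤ t' / t - 1 := Real.log_le_sub_one_of_pos (by positivity)
    rw [Real.log_div ht'.ne' ht.ne'] at h3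
    have h4 : 1 ≤ m ^ 2 := one_le_pow₀ hm1
    have h5 : 1 ≤ (t' / t) ^ 2 := one_le_pow₀ hx1
    nlinarith [mul_nonneg (sub_nonneg.2 h4) (sub_nonneg.2 h5)]
  have h5 : max 1 √(-Real.log t) ≤ m * (t' / t) := by
    refine max_le (by nlinarith) ?_
    rw [Real.sqrt_le_left (by positivity), mul_pow]
    exact hlog
  calc t * max 1 √(-Real.log t) ≤ t * (m * (t' / t)) := by gcongr
    _ = t' * m := by field_simp

lemma riskTransfer_mono (h0 : 0 < δ) (h1 : δ < 1) {t t' : ℝ} (ht : 0 ≤ t) (h : t ≤ t') :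
    riskTransfer δ t ≤ riskTransfer δ t' := by
  have hb : 0 < δ / (1 - δ) := div_pos h0 (by linarith)
  rw [riskTransfer_eq h0 h1 ht, riskTransfer_eq h0 h1 (ht.trans h)]
  have := mul_max_one_sqrt_neg_log_mono ht h
  have ht' := ht.trans h
  gcongr

lemma riskTransfer_log_factor_anti (h0 : 0 < δ) (h1 : δ < 1) {t t' : ℝ} (ht : 0 < t)
    (h : t ≤ t') :
    max 1 (√(-Real.log t') ^ (δ / (1 - δ))) ≤ max 1 (√(-Real.log t) ^ (δ / (1 - δ))) := by
  have hb : 0 < δ / (1 - δ) := div_pos h0 (by linarith)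
  have := Real.log_le_log ht h
  gcongr

lemma riskTransfer_mul_le (h0 : 0 < δ) (h1 : δ < 1) {c t : ℝ} (hc : 1 ≤ c) (ht : 0 < t) :
    riskTransfer δ (c * t) ≤ c ^ (1 / (1 - δ)) * riskTransfer δ t := by
  have := riskTransfer_log_factor_anti h0 h1 ht (le_mul_of_one_le_left ht.le hc)
  rw [riskTransfer, riskTransfer, Real.mul_rpow (by linarith) ht.le, mul_assoc]
  gcongr

lemma half_le_gaussCDF_of_nonneg {x : ℝ} (hx : 0 ≤ x) : 1 / 2 ≤ gaussCDF x := by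
  have h1 := gaussCDF_add_neg x
  have h2 := gaussCDF_mono (show -x ≤ x by linarith)
  linarith

lemma gaussCDF_neg_eq (x : ℝ) :
    gaussCDF (-x) = Real.exp (-(x ^ 2) / 2) * mills (-x) / √(2 * Real.pi) := by
  rw [gaussCDF, mills, neg_sq, ← mul_assoc, ← Real.exp_add,
    show -x ^ 2 / 2 + x ^ 2 / 2 = 0 by ring, Real.exp_zero, one_mul]

lemma gaussCDF_neg_le_two_mul {s z : ℝ} (hs0 : 0 ≤ s) (hs1 : s ≤ 1) :
    gaussCDF (-z) ≤ 2 * gaussCDF (-(s * z)) := by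
  rcases le_total 0 z with hz | hz
  · have h1 := gaussCDF_mono (show -z ≤ -(s * z) by nlinarith)
    linarith [gaussCDF_pos (-(s * z))]
  · have h1 := half_le_gaussCDF_of_nonneg (show 0 ≤ -(s * z) by nlinarith)
    linarith [gaussCDF_lt_one (-z)]

/-- The absolute constant of the comparison of Gaussian tails. -/
noncomputable def tailConst : ℝ := 9 * Real.exp (3 / 2)

lemma two_le_tailConst : 2 ≤ tailConst := by
  have : 1 ≤ Real.exp (3 / 2) := Real.one_le_exp (by norm_num)
  unfold tailConst; linarith

/-- Comparison of Gaussian tails: shrinking the argument by `√(1 - δ)` changes the tail by the power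
`1 - δ`, up to the correction by the polynomial factors in the Mills ratios, which is logarithmic in
the tail. -/
lemma gaussCDF_neg_le_riskTransfer (h0 : 0 < δ) (h1 : δ < 1) (z : ℝ) :
    gaussCDF (-z) ≤
      tailConst ^ (1 / (1 - δ)) * riskTransfer δ (gaussCDF (-(√(1 - δ) * z))) := by
  have hp : 0 < 1 - δ := by linarith
  have hb : 0 < δ / (1 - δ) := div_pos h0 hp
  have ha : 0 < 1 / (1 - δ) := by positivity
  set q := gaussCDF (-(√(1 - δ) * z)) with hq
  have hq0 : 0 < q := gaussCDF_pos _
  have hK := two_le_tailConst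
  rcases le_total z 0 with hz | hz
  · have hhalf : 1 / 2 ≤ q :=
      half_le_gaussCDF_of_nonneg (by nlinarith [Real.sqrt_nonneg (1 - δ)])
    calc gaussCDF (-z) ≤ 1 := (gaussCDF_lt_one _).le
      _ ≤ (tailConst * q) ^ (1 / (1 - δ)) * 1 := by
          rw [mul_one]; exact Real.one_le_rpow (by nlinarith) ha.le
      _ = tailConst ^ (1 / (1 - δ)) * (q ^ (1 / (1 - δ)) * 1) := by
          rw [Real.mul_rpow (by linarith) hq0.le]; ring
      _ ≤ _ := by
          have hT : 0 < tailConst := by linarith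
          unfold riskTransfer
          gcongr
          exact le_max_left _ _
  set x := √(1 - δ) * z with hx
  have hx0 : 0 ≤ x := by positivity
  have hxz : x ≤ z := mul_le_of_le_one_left hz (Real.sqrt_le_one.2 (by linarith))
  set L := max 1 √(-Real.log q) with hL
  have hL1 : 1 ≤ L := le_max_left _ _
  have hpi2 : 2 ≤ √(2 * Real.pi) := by
    rw [Real.le_sqrt' (by norm_num)]; linarith [Real.pi_gt_three]
  have hpi3 : √(2 * Real.pi) ≤ 3 := by
    rw [Real.sqrt_le_left (by norm_num)]; linarith [Real.pi_lt_four]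
  -- the tail at `z`, from above
  have hup : gaussCDF (-z) ≤ 3 * Real.exp (-(z ^ 2) / 2) / (1 + z) := by
    have hm : mills (-z) * (1 + z) ≤ 3 := by
      nlinarith [mills_neg_le_two hz, mul_mills_neg_le_one hz]
    rw [gaussCDF_neg_eq, le_div_iff₀ (by linarith), div_mul_eq_mul_div, div_le_iff₀ (by linarith)]
    have he := Real.exp_pos (-(z ^ 2) / 2)
    nlinarith
  -- the tail at `x`, from below
  have hlow : Real.exp (-(x ^ 2) / 2) ≤ 3 * Real.exp (3 / 2) * (1 + x) * q := by
    have hm := mills_neg_ge hx0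
    rw [div_le_iff₀ (by linarith)] at hm
    have h3 : 1 ≤ Real.exp (3 / 2) * (mills (-x) * (1 + x)) := by
      calc (1 : ℝ) = Real.exp (3 / 2) * Real.exp (-(3 / 2)) := by
            rw [← Real.exp_add]; simp
        _ ≤ _ := by gcongr
    have h4 : Real.exp (-(x ^ 2) / 2) * mills (-x) ≤ 3 * q := by
      have : q * √(2 * Real.pi) = Real.exp (-(x ^ 2) / 2) * mills (-x) := by
        rw [hq, gaussCDF_neg_eq, div_mul_cancel₀ _ sqrt_two_pi_pos.ne']
      nlinarith
    calc Real.exp (-(x ^ 2) / 2)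
        ≤ Real.exp (-(x ^ 2) / 2) * (Real.exp (3 / 2) * (mills (-x) * (1 + x))) :=
          le_mul_of_one_le_right (Real.exp_pos _).le h3
      _ = Real.exp (3 / 2) * (1 + x) * (Real.exp (-(x ^ 2) / 2) * mills (-x)) := by ring
      _ ≤ Real.exp (3 / 2) * (1 + x) * (3 * q) := by gcongr
      _ = _ := by ring
  -- the polynomial factor at `x` is logarithmic in the tail
  have hxL : 1 + x ≤ 3 * L := by
    have h5 : q ≤ Real.exp (-(x ^ 2) / 2) := by
      rw [hq, gaussCDF_neg_eq, div_le_iff₀ (by linarith)]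
      have := mills_neg_le_two hx0
      have he := Real.exp_pos (-(x ^ 2) / 2)
      nlinarith
    have h6 := Real.log_le_log hq0 h5
    rw [Real.log_exp] at h6
    have h7 : -Real.log q ≤ L ^ 2 := (Real.sqrt_le_left (by linarith)).1 (le_max_right _ _)
    nlinarith
  have hpow : Real.exp (-(z ^ 2) / 2) = Real.exp (-(x ^ 2) / 2) ^ (1 / (1 - δ)) := by
    rw [← Real.exp_mul, hx, mul_pow, Real.sq_sqrt hp.le]
    congr 1; field_simp
  have hE : Real.exp (-(z ^ 2) / 2) / (1 + z) ≤
      (3 * Real.exp (3 / 2) * q) ^ (1 / (1 - δ)) * (3 * L) ^ (δ / (1 - δ)) := by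
    calc Real.exp (-(z ^ 2) / 2) / (1 + z)
        ≤ (3 * Real.exp (3 / 2) * (1 + x) * q) ^ (1 / (1 - δ)) / (1 + x) := by
          rw [hpow]; gcongr
      _ = (3 * Real.exp (3 / 2) * q) ^ (1 / (1 - δ)) * (1 + x) ^ (δ / (1 - δ)) := by
          rw [show 3 * Real.exp (3 / 2) * (1 + x) * q = (3 * Real.exp (3 / 2) * q) * (1 + x) by ring,
            Real.mul_rpow (by positivity) (by positivity),
            one_div_one_sub_eq h1, Real.rpow_add (show 0 < 1 + x by linarith), Real.rpow_one]
          field_simp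
      _ ≤ _ := by gcongr
  calc gaussCDF (-z) ≤ 3 * (Real.exp (-(z ^ 2) / 2) / (1 + z)) := by rw [← mul_div_assoc]; exact hup
    _ ≤ 3 * ((3 * Real.exp (3 / 2) * q) ^ (1 / (1 - δ)) * (3 * L) ^ (δ / (1 - δ))) := by gcongr
    _ = _ := by
        have h3 : (3 : ℝ) * 3 ^ (δ / (1 - δ)) = 3 ^ (1 / (1 - δ)) := by
          rw [one_div_one_sub_eq h1, Real.rpow_add (by norm_num), Real.rpow_one]
        rw [riskTransfer, max_one_rpow_eq (Real.sqrt_nonneg _) hb.le, ← hL,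
          show tailConst = 3 * (3 * Real.exp (3 / 2)) by unfold tailConst; ring,
          Real.mul_rpow (x := 3) (y := 3 * Real.exp (3 / 2)) (by norm_num) (by positivity),
          Real.mul_rpow (x := 3) (y := L) (by norm_num) (by positivity),
          Real.mul_rpow (x := 3 * Real.exp (3 / 2)) (y := q) (by positivity) hq0.le, ← h3]
        ring

end Transfer

/-! ### Excess risk as a sum over topics -/

namespace PoissonTopicModel

variable {d T : ℕ} (M : PoissonTopicModel d T)

/-- The law of label, topic and document when the document has law `p τ` given the topic `τ`. -/
noncomputable def lawWith (p : Fin T → PMF (Fin d → ℕ)) : PMF (Bool × Fin T × (Fin d → ℕ)) :=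
  M.labelLaw.bind fun y => (M.topicLaw y).bind fun τ => (p τ).map fun x => (y, τ, x)

/-- The joint probability of the label `y` and the topic `τ`. -/
noncomputable def jointProb (y : Bool) (τ : Fin T) : ℝ :=
  (M.labelLaw y).toReal * (M.topicLaw y τ).toReal

/-- The surplus probability of the more likely label of the topic `τ` over the other label. -/
noncomputable def topicGap (τ : Fin T) : ℝ :=
  M.jointProb (M.bestLabel τ) τ - M.jointProb (!M.bestLabel τ) τ

lemma jointProb_nonneg (y : Bool) (τ : Fin T) : 0 ≤ M.jointProb y τ := by
  unfold jointProb; positivity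

lemma lawWith_real (p : Fin T → PMF (Fin d → ℕ)) (A : Set (Bool × Fin T × (Fin d → ℕ))) :
    (M.lawWith p).toMeasure.real A =
      ∑ y, ∑ τ, M.jointProb y τ * (p τ).toMeasure.real {x | (y, τ, x) ∈ A} := by
  have hA : MeasurableSet A := .of_discrete
  have h : (M.lawWith p).toMeasure A = ∑ y, ∑ τ, M.labelLaw y * M.topicLaw y τ *
      (p τ).toMeasure {x | (y, τ, x) ∈ A} := by
    rw [lawWith, PMF.toMeasure_bind_apply _ _ _ hA, tsum_fintype]
    refine Finset.sum_congr rfl fun y _ => ?_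
    rw [PMF.toMeasure_bind_apply _ _ _ hA, tsum_fintype, Finset.mul_sum]
    refine Finset.sum_congr rfl fun τ _ => ?_
    rw [PMF.toMeasure_map_apply _ _ _ .of_discrete hA, mul_assoc]
    rfl
  have hfin : ∀ y τ, M.labelLaw y * M.topicLaw y τ *
      (p τ).toMeasure {x | (y, τ, x) ∈ A} ≠ ⊤ := fun y τ =>
    ENNReal.mul_ne_top (ENNReal.mul_ne_top (PMF.apply_ne_top _ _) (PMF.apply_ne_top _ _))
      (measure_ne_top _ _)
  rw [measureReal_def, h, ENNReal.toReal_sum fun y _ => ENNReal.sum_ne_top.2 fun τ _ => hfin y τ]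
  refine Finset.sum_congr rfl fun y _ => ?_
  rw [ENNReal.toReal_sum fun τ _ => hfin y τ]
  refine Finset.sum_congr rfl fun τ _ => ?_
  rw [ENNReal.toReal_mul, ENNReal.toReal_mul, jointProb, measureReal_def]

lemma dataLaw_eq_lawWith : M.dataLaw = M.lawWith M.wordLaw := rfl

lemma dropLaw_eq_lawWith (δ : unitInterval) :
    M.dropLaw δ = M.lawWith fun τ => (M.wordLaw τ).bind (thinLaw δ) := by
  simp only [dropLaw, dataLaw, lawWith, PMF.bind_bind, PMF.bind_map, PMF.map_bind]
  rfl

lemma topicProb_eq (τ : Fin T) : M.topicProb τ = ∑ y, M.jointProb y τ := by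
  rw [topicProb, dataLaw_eq_lawWith, lawWith_real]
  refine Finset.sum_congr rfl fun y _ => ?_
  rw [Finset.sum_eq_single τ]
  · simp
  · intro τ' _ hne
    simp [hne]
  · simp

lemma labelProb_eq (c : Bool) (τ : Fin T) :
    M.labelProb c τ = M.jointProb c τ / M.topicProb τ := by
  rw [labelProb, measureReal_def, cond_apply .of_discrete, ENNReal.toReal_mul, ENNReal.toReal_inv,
    ← measureReal_def, ← measureReal_def, topicProb, div_eq_inv_mul]
  congr 1
  rw [dataLaw_eq_lawWith, lawWith_real, Finset.sum_eq_single c, Finset.sum_eq_single τ]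
  · simp
  · intro τ' _ hne
    simp [hne]
  · simp
  · intro y _ hne
    simp [hne]
  · simp

lemma errMin_eq : M.errMin = ∑ τ, M.jointProb (!M.bestLabel τ) τ := by
  rw [errMin, dataLaw_eq_lawWith, lawWith_real, Finset.sum_comm]
  refine Finset.sum_congr rfl fun τ _ => ?_
  rw [Fintype.sum_bool]
  cases h : M.bestLabel τ <;> simp [h]

lemma sum_topicProb : ∑ τ, M.topicProb τ = 1 := by
  have h := M.lawWith_real M.wordLaw Set.univ
  simp only [topicProb_eq]
  rw [Finset.sum_comm]
  simpa using h.symm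

/-- A rule errs in excess of `errMin` exactly to the extent that it decides against the more likely
label of a topic. -/
lemma lawWith_err_sub_errMin (p : Fin T → PMF (Fin d → ℕ)) (w : Fin d → ℝ) :
    (M.lawWith p).toMeasure.real {ω | ω.1 ≠ linearRule w ω.2.2} - M.errMin =
      ∑ τ, M.topicGap τ * (p τ).toMeasure.real {x | linearRule w x ≠ M.bestLabel τ} := by
  rw [lawWith_real, Finset.sum_comm, errMin_eq, ← Finset.sum_sub_distrib]
  refine Finset.sum_congr rfl fun τ _ => ?_
  have hcompl : (p τ).toMeasure.real {x | linearRule w x ≠ !M.bestLabel τ} =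
      1 - (p τ).toMeasure.real {x | linearRule w x ≠ M.bestLabel τ} := by
    rw [← probReal_compl_eq_one_sub .of_discrete]
    congr 1
    ext x
    cases h1 : linearRule w x <;> cases h2 : M.bestLabel τ <;> simp [h1]
  have hsum : ∑ y, M.jointProb y τ *
      (p τ).toMeasure.real {x | (y, τ, x) ∈ {ω : Bool × Fin T × (Fin d → ℕ) |
        ω.1 ≠ linearRule w ω.2.2}} =
      M.jointProb (M.bestLabel τ) τ *
        (p τ).toMeasure.real {x | linearRule w x ≠ M.bestLabel τ} +
      M.jointProb (!M.bestLabel τ) τ *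
        (p τ).toMeasure.real {x | linearRule w x ≠ !M.bestLabel τ} := by
    have hset : ∀ y, {x | (y, τ, x) ∈ {ω : Bool × Fin T × (Fin d → ℕ) |
        ω.1 ≠ linearRule w ω.2.2}} = {x | linearRule w x ≠ y} := fun y => by
      ext x; exact ne_comm
    simp only [hset, Fintype.sum_bool]
    cases M.bestLabel τ <;> simp [add_comm]
  rw [hsum, hcompl, topicGap]
  ring

lemma err_sub_errMin (w : Fin d → ℝ) : M.err w - M.errMin =
    ∑ τ, M.topicGap τ * (poissonPi (M.rate τ)).real {x | linearRule w x ≠ M.bestLabel τ} := by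
  rw [err, dataLaw_eq_lawWith, lawWith_err_sub_errMin]
  simp only [wordLaw, Measure.toPMF_toMeasure]

lemma errDrop_sub_errMin (δ : unitInterval) (w : Fin d → ℝ) : M.errDrop δ w - M.errMin =
    ∑ τ, M.topicGap τ *
      (poissonPi fun j => unitInterval.toNNReal (unitInterval.symm δ) * M.rate τ j).real
        {x | linearRule w x ≠ M.bestLabel τ} := by
  rw [errDrop, dropLaw_eq_lawWith, lawWith_err_sub_errMin]
  simp only [wordLaw, poissonPi_bind_thinLaw, Measure.toPMF_toMeasure]

lemma topicGap_le_topicProb (τ : Fin T) : M.topicGap τ ≤ M.topicProb τ := by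
  rw [topicGap, topicProb_eq, Fintype.sum_bool]
  have h1 := M.jointProb_nonneg true τ
  have h2 := M.jointProb_nonneg false τ
  cases M.bestLabel τ <;> simp <;> linarith

lemma two_mul_le_topicGap {pmin α : ℝ} (hp : 0 < pmin) (hα : 0 < α) {τ : Fin T}
    (h1 : pmin ≤ M.topicProb τ) (h2 : ∀ c, α ≤ |M.labelProb c τ - 1 / 2|) :
    2 * (α * pmin) ≤ M.topicGap τ := by
  have htp : 0 < M.topicProb τ := hp.trans_le h1
  have hjoint : ∀ c, M.jointProb c τ = M.topicProb τ * M.labelProb c τ := fun c => by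
    rw [labelProb_eq]; field_simp
  have hone : M.labelProb true τ + M.labelProb false τ = 1 := by
    rw [labelProb_eq, labelProb_eq, ← add_div, div_eq_one_iff_eq htp.ne', topicProb_eq,
      Fintype.sum_bool]
  have hgap : α ≤ (M.labelProb (M.bestLabel τ) τ - M.labelProb (!M.bestLabel τ) τ) / 2 := by
    refine (h2 (M.bestLabel τ)).trans_eq ?_
    by_cases h : M.labelProb false τ < M.labelProb true τ
    · have hb : M.bestLabel τ = true := by simp [bestLabel, h]
      rw [hb, abs_of_nonneg (by linarith)]; simp; linarith
    · have hb : M.bestLabel τ = false := by simp [bestLabel, h]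
      rw [hb, abs_of_nonneg (by linarith)]; simp; linarith
  rw [topicGap, hjoint, hjoint, ← mul_sub]
  nlinarith

end PoissonTopicModel

/-! ### From the excess dropout risk to the excess risk -/

section Transfer

variable {ι : Type*} [Fintype ι] {δ e A B C D η ρ m : ℝ} {q ε ε' g g' : ι → ℝ}

/-- The excess risk is linear in the excess dropout risk, which suffices when the latter is below
the error `e` of the normal approximation. -/
lemma sum_mul_le_of_le_two_mul (hδ1 : δ < 1) (hδ0 : 0 < δ) (hq : ∀ i, 0 ≤ q i) (hq1 : ∑ i, q i ≤ 1)
    (he : 0 ≤ e) (hA : 0 ≤ A)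
    (hε : ∀ i, ε i ≤ g i + A * e) (hε' : ∀ i, g' i ≤ ε' i + A * e / √(1 - δ))
    (hg : ∀ i, g i ≤ 2 * g' i) (hrisk : ∑ i, q i * ε' i ≤ D) :
    ∑ i, q i * ε i ≤ 2 * D + 3 * A * e / √(1 - δ) := by
  have hs : 0 < √(1 - δ) := Real.sqrt_pos.2 (by linarith)
  have hs1 : √(1 - δ) ≤ 1 := Real.sqrt_le_one.2 (by linarith)
  have hAe : A * e ≤ A * e / √(1 - δ) := le_div_self (by positivity) hs hs1
  calc ∑ i, q i * ε i ≤ ∑ i, (2 * (q i * ε' i) + q i * (3 * (A * e / √(1 - δ)))) := by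
        refine Finset.sum_le_sum fun i _ => ?_
        nlinarith [mul_le_mul_of_nonneg_left
          (show ε i ≤ 2 * ε' i + 3 * (A * e / √(1 - δ)) by linarith [hε i, hε' i, hg i]) (hq i)]
    _ = 2 * ∑ i, q i * ε' i + (∑ i, q i) * (3 * (A * e / √(1 - δ))) := by
        rw [Finset.sum_add_distrib, Finset.mul_sum, Finset.sum_mul]
    _ ≤ 2 * D + 1 * (3 * (A * e / √(1 - δ))) := by gcongr
    _ = _ := by ring

/-- Transfer of the risk with the factor `1 / m` inside the power, where `m` is a lower bound on the
weights `q`: each single error probability is at most the total risk over `m`. -/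
lemma sum_mul_le_riskTransfer_div (hδ0 : 0 < δ) (hδ1 : δ < 1) (hq : ∀ i, m ≤ q i)
    (hq1 : ∑ i, q i ≤ 1) (hm : 0 < m) (hm1 : m ≤ 1) (he : 0 ≤ e) (hA : 0 ≤ A) (hC : 0 ≤ C)
    (hD : 1 ≤ D) (hρ : 0 < ρ) (heρ : e ≤ ρ)
    (hε : ∀ i, ε i ≤ g i + A * e) (hε' : ∀ i, g' i ≤ ε' i + A * e / √(1 - δ))
    (hε'0 : ∀ i, 0 ≤ ε' i) (hg'0 : ∀ i, 0 ≤ g' i)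
    (hg : ∀ i, g i ≤ C ^ (1 / (1 - δ)) * riskTransfer δ (g' i))
    (hrisk : ∑ i, q i * ε' i ≤ D * ρ) :
    ∑ i, q i * ε i ≤ (C * (D + A) / √(1 - δ)) ^ (1 / (1 - δ)) *
      ((ρ / m) ^ (1 / (1 - δ)) * max 1 (√(-Real.log ρ) ^ (δ / (1 - δ)))) + A * e := by
  have hs : 0 < √(1 - δ) := Real.sqrt_pos.2 (by linarith)
  have hs1 : √(1 - δ) ≤ 1 := Real.sqrt_le_one.2 (by linarith)
  set c := (D + A) / √(1 - δ) / m with hc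
  have hc1 : 1 ≤ c := by
    rw [hc, one_le_div hm, le_div_iff₀ hs]
    nlinarith
  have hg' : ∀ i, g' i ≤ c * ρ := by
    intro i
    have h1 : m * ε' i ≤ D * ρ := by
      calc m * ε' i ≤ q i * ε' i := mul_le_mul_of_nonneg_right (hq i) (hε'0 i)
        _ ≤ ∑ i, q i * ε' i := Finset.single_le_sum
            (f := fun i => q i * ε' i)
            (fun i _ => mul_nonneg (hm.le.trans (hq i)) (hε'0 i)) (Finset.mem_univ i)
        _ ≤ _ := hrisk
    have h2 : ε' i ≤ D * ρ / √(1 - δ) / m := by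
      rw [le_div_iff₀ hm]
      exact (by linarith : ε' i * m ≤ D * ρ).trans (le_div_self (by positivity) hs hs1)
    have h3 : A * e / √(1 - δ) ≤ A * ρ / √(1 - δ) / m := by
      refine le_trans ?_ (le_div_self (by positivity) hm hm1)
      gcongr
    calc g' i ≤ D * ρ / √(1 - δ) / m + A * ρ / √(1 - δ) / m := by linarith [hε' i]
      _ = c * ρ := by rw [hc]; ring
  set R := C ^ (1 / (1 - δ)) * (c ^ (1 / (1 - δ)) * riskTransfer δ ρ) with hR
  have hR0 : 0 ≤ R := by
    have := riskTransfer_nonneg (δ := δ) hρ.le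
    positivity
  have hRle : ∀ i, g i ≤ R := fun i => by
    refine (hg i).trans ?_
    have := (riskTransfer_mono hδ0 hδ1 (hg'0 i) (hg' i)).trans
      (riskTransfer_mul_le hδ0 hδ1 hc1 hρ)
    rw [hR]; gcongr
  have hReq : R = (C * (D + A) / √(1 - δ)) ^ (1 / (1 - δ)) *
      ((ρ / m) ^ (1 / (1 - δ)) * max 1 (√(-Real.log ρ) ^ (δ / (1 - δ)))) := by
    rw [hR, riskTransfer, ← mul_assoc, ← mul_assoc, ← mul_assoc,
      ← Real.mul_rpow hC (by positivity), ← Real.mul_rpow (by positivity) hρ.le,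
      ← Real.mul_rpow (by positivity) (by positivity)]
    congr 2
    rw [hc]; ring
  rw [← hReq]
  calc ∑ i, q i * ε i ≤ ∑ i, q i * (R + A * e) := by
        refine Finset.sum_le_sum fun i _ => mul_le_mul_of_nonneg_left ?_ (hm.le.trans (hq i))
        linarith [hε i, hRle i]
    _ = (∑ i, q i) * (R + A * e) := by rw [Finset.sum_mul]
    _ ≤ 1 * (R + A * e) := by gcongr
    _ = _ := one_mul _

/-- Transfer of the risk with the factor `1 / m` outside the power. One factor of each error
probability is summed against the weights, and only the remaining power, of exponent
`δ / (1 - δ) ≤ 1`, is bounded through `m`. -/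
lemma sum_mul_le_div_mul_riskTransfer (hδ0 : 0 < δ) (hδ2 : δ ≤ 1 / 2) (hq : ∀ i, m ≤ q i)
    (hq1 : ∑ i, q i ≤ 1) (hm : 0 < m) (hm1 : m ≤ 1) (he : 0 ≤ e) (hA : 0 ≤ A) (hC : 1 ≤ C)
    (hD : 1 ≤ D) (hρ : 0 < ρ) (heρ : e ≤ ρ)
    (hε : ∀ i, ε i ≤ g i + A * e) (hε' : ∀ i, g' i ≤ ε' i + A * e / √(1 - δ))
    (hε'0 : ∀ i, 0 ≤ ε' i) (hg'0 : ∀ i, 0 ≤ g' i)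
    (hg : ∀ i, g i ≤ C ^ (1 / (1 - δ)) * riskTransfer δ (g' i))
    (hrisk : ∑ i, q i * ε' i ≤ D * ρ) :
    ∑ i, q i * ε i ≤ (C * (D + 1 + 2 * A)) ^ 2 / m * riskTransfer δ ρ + A * e := by
  have hδ1 : δ < 1 := by linarith
  have hs : 0 < √(1 - δ) := Real.sqrt_pos.2 (by linarith)
  have hs2 : 1 / 2 ≤ √(1 - δ) := by rw [Real.le_sqrt' (by norm_num)]; linarith
  have hb : 0 < δ / (1 - δ) := div_pos hδ0 (by linarith)
  have hb1 : δ / (1 - δ) ≤ 1 := by rw [div_le_one (by linarith)]; linarith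
  have hae := one_div_one_sub_eq hδ1
  have ha2 : 1 / (1 - δ) ≤ 2 := by linarith
  set E := D + 1 + 2 * A with hE
  have hE1 : 1 ≤ E := by linarith
  set L := max 1 (√(-Real.log ρ) ^ (δ / (1 - δ))) with hL
  have hL1 : 1 ≤ L := le_max_left _ _
  have hq0 : ∀ i, 0 ≤ q i := fun i => hm.le.trans (hq i)
  -- enlarging the error probabilities to at least `ρ` makes the logarithmic factor uniform
  set t : ι → ℝ := fun i => ε' i + (1 + 2 * A) * ρ with ht
  have htρ : ∀ i, ρ ≤ t i := fun i => by
    have : 0 ≤ A * ρ := by positivity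
    have := hε'0 i
    simp only [ht]; nlinarith
  have hg't : ∀ i, g' i ≤ t i := fun i => by
    have h1 : A * e / √(1 - δ) ≤ 2 * A * ρ := by
      rw [div_le_iff₀ hs]
      have h2 : A * e ≤ A * ρ := by gcongr
      have : 0 ≤ A * ρ := by positivity
      nlinarith
    have := hε' i
    simp only [ht]; nlinarith
  have hsum : ∑ i, q i * t i ≤ E * ρ := by
    simp only [ht, mul_add, Finset.sum_add_distrib, ← Finset.sum_mul]
    have : (∑ i, q i) * ((1 + 2 * A) * ρ) ≤ 1 * ((1 + 2 * A) * ρ) := by gcongr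
    rw [hE]; nlinarith
  have htm : ∀ i, t i ≤ E / m * ρ := fun i => by
    rw [div_mul_eq_mul_div, le_div_iff₀ hm]
    have htpos : 0 ≤ t i := hρ.le.trans (htρ i)
    calc t i * m ≤ q i * t i := by rw [mul_comm]; exact mul_le_mul_of_nonneg_right (hq i) htpos
      _ ≤ ∑ i, q i * t i := Finset.single_le_sum (f := fun i => q i * t i)
          (fun i _ => mul_nonneg (hq0 i) (hρ.le.trans (htρ i))) (Finset.mem_univ i)
      _ ≤ _ := hsum
  have hEm : 1 ≤ E / m := by rw [one_le_div hm]; linarith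
  have hgt : ∀ i, g i ≤ C ^ 2 * (E / m) * ρ ^ (δ / (1 - δ)) * L * t i := by
    intro i
    have htpos : 0 < t i := hρ.trans_le (htρ i)
    have h1 : C ^ (1 / (1 - δ)) ≤ C ^ 2 := by
      rw [← Real.rpow_two]; exact Real.rpow_le_rpow_of_exponent_le hC ha2
    have h2 : riskTransfer δ (g' i) ≤ t i * (E / m * ρ ^ (δ / (1 - δ))) * L := by
      refine (riskTransfer_mono hδ0 hδ1 (hg'0 i) (hg't i)).trans ?_
      have h3 : (t i) ^ (δ / (1 - δ)) ≤ E / m * ρ ^ (δ / (1 - δ)) := by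
        calc (t i) ^ (δ / (1 - δ)) ≤ (E / m * ρ) ^ (δ / (1 - δ)) := by
              have := htm i
              gcongr
          _ = (E / m) ^ (δ / (1 - δ)) * ρ ^ (δ / (1 - δ)) :=
              Real.mul_rpow (by linarith) hρ.le
          _ ≤ (E / m) ^ (1 : ℝ) * ρ ^ (δ / (1 - δ)) := by gcongr
          _ = _ := by rw [Real.rpow_one]
      have h4 := riskTransfer_log_factor_anti hδ0 hδ1 hρ (htρ i)
      rw [riskTransfer, hae, Real.rpow_add htpos, Real.rpow_one]
      gcongr
    calc g i ≤ C ^ (1 / (1 - δ)) * riskTransfer δ (g' i) := hg i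
      _ ≤ C ^ 2 * (t i * (E / m * ρ ^ (δ / (1 - δ))) * L) := by
          have := riskTransfer_nonneg (δ := δ) (hg'0 i)
          gcongr
      _ = _ := by ring
  set H := C ^ 2 * (E / m) * ρ ^ (δ / (1 - δ)) * L with hH
  have hH0 : 0 ≤ H := by positivity
  calc ∑ i, q i * ε i ≤ ∑ i, (H * (q i * t i) + q i * (A * e)) := by
        refine Finset.sum_le_sum fun i _ => ?_
        nlinarith [mul_le_mul_of_nonneg_left
          (show ε i ≤ H * t i + A * e by linarith [hε i, hgt i]) (hq0 i)]
    _ = H * ∑ i, q i * t i + (∑ i, q i) * (A * e) := by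
        rw [Finset.sum_add_distrib, Finset.mul_sum, Finset.sum_mul]
    _ ≤ H * (E * ρ) + 1 * (A * e) := by gcongr
    _ = _ := by
        rw [riskTransfer, ← hL, hH, hae, Real.rpow_add hρ, Real.rpow_one]
        ring

/-- The constant in the bounds of the excess risk by the excess dropout risk, where the best dropout
risk exceeds its lower bound by `B * e`. -/
noncomputable def transferConst (A B C : ℝ) : ℝ := 2 * (C * (1 + B + 1 + 2 * A)) ^ 2

/-- Both bounds of the excess risk `∑ i, q i * ε i` by the excess dropout risk `ρ`. If `ρ` is at
most the normal approximation error `e`, the power `1 / (1 - δ)` plays no role. -/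
lemma sum_mul_le_transferConst (hδ0 : 0 < δ) (hδ1 : δ < 1) (hqm : ∀ i, m ≤ q i)
    (hq1 : ∑ i, q i ≤ 1) (hm : 0 < m) (hm1 : m ≤ 1) (he0 : 0 < e) (hA0 : 0 ≤ A) (hB : 0 ≤ B)
    (hC2 : 2 ≤ C) (hρ0 : 0 ≤ ρ)
    (hε : ∀ i, ε i ≤ g i + A * e) (hε' : ∀ i, g' i ≤ ε' i + A * e / √(1 - δ))
    (hε'0 : ∀ i, 0 ≤ ε' i) (hg'0 : ∀ i, 0 ≤ g' i) (hg2 : ∀ i, g i ≤ 2 * g' i)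
    (hg : ∀ i, g i ≤ C ^ (1 / (1 - δ)) * riskTransfer δ (g' i))
    (hrisk : ∑ i, q i * ε' i ≤ ρ + B * e) (hηle : η ≤ ∑ i, q i * ε i) :
    η ≤ (transferConst A B C / √(1 - δ)) ^ (1 / (1 - δ)) *
        ((ρ / m) ^ (1 / (1 - δ)) * max 1 (√(-Real.log ρ) ^ (δ / (1 - δ))) + e) ∧
    (δ ≤ 1 / 2 → η ≤ transferConst A B C / m *
        (ρ ^ (1 / (1 - δ)) * max 1 (√(-Real.log ρ) ^ (δ / (1 - δ))) + e)) := by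
  have hp : 0 < 1 - δ := by linarith
  have hs : 0 < √(1 - δ) := Real.sqrt_pos.2 hp
  have hs1 : √(1 - δ) ≤ 1 := Real.sqrt_le_one.2 (by linarith)
  have hq0 : ∀ i, 0 ≤ q i := fun i => hm.le.trans (hqm i)
  set D : ℝ := 1 + B with hD
  set E : ℝ := C * (D + 1 + 2 * A) with hE
  have hD1 : 1 ≤ D := by linarith
  have hE_ge : 2 * (D + 1 + 2 * A) ≤ E := mul_le_mul_of_nonneg_right hC2 (by positivity)
  have hE1 : 1 ≤ E := by linarith
  have hEsq : E ≤ E ^ 2 := le_self_pow₀ hE1 two_ne_zero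
  set K : ℝ := transferConst A B C with hKdef
  have hK : K = 2 * E ^ 2 := rfl
  have ha1 : 1 ≤ 1 / (1 - δ) := by rw [one_le_div hp]; linarith
  have hKE : 2 * E ≤ K := by linarith
  have hKs1 : 1 ≤ K / √(1 - δ) := by rw [one_le_div hs]; linarith
  have hKpow : K / √(1 - δ) ≤ (K / √(1 - δ)) ^ (1 / (1 - δ)) :=
    Real.self_le_rpow_of_one_le hKs1 ha1
  have hKs : K ≤ K / √(1 - δ) := le_div_self (by linarith) hs hs1
  have hKm : K ≤ K / m := le_div_self (by linarith) hm hm1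
  rcases le_or_gt ρ e with hcase | hcase
  · have hlin : η ≤ E * e / √(1 - δ) := by
      have h1 := sum_mul_le_of_le_two_mul hδ1 hδ0 hq0 hq1 he0.le hA0 hε hε' hg2 hrisk
      have h2 : 2 * (ρ + B * e) ≤ 2 * D * e / √(1 - δ) := by
        refine le_trans ?_ (le_div_self (by positivity) hs hs1)
        rw [hD]; nlinarith
      have h3 : 2 * D * e / √(1 - δ) + 3 * A * e / √(1 - δ) ≤ E * e / √(1 - δ) := by
        rw [← add_div, ← add_mul]
        gcongr
        linarith
      linarith
    have hF : 0 ≤ ρ ^ (1 / (1 - δ)) * max 1 (√(-Real.log ρ) ^ (δ / (1 - δ))) :=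
      riskTransfer_nonneg hρ0
    refine ⟨?_, fun hδ2 => ?_⟩
    · have hF' : 0 ≤ (ρ / m) ^ (1 / (1 - δ)) * max 1 (√(-Real.log ρ) ^ (δ / (1 - δ))) := by
        positivity
      calc η ≤ E * e / √(1 - δ) := hlin
        _ ≤ K / √(1 - δ) * e := by
            rw [mul_div_right_comm]; gcongr; linarith
        _ ≤ (K / √(1 - δ)) ^ (1 / (1 - δ)) * e := by gcongr
        _ ≤ _ := by
            refine mul_le_mul_of_nonneg_left ?_ (by linarith)
            linarith
    · have hs2 : 1 / 2 ≤ √(1 - δ) := by rw [Real.le_sqrt' (by norm_num)]; linarith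
      calc η ≤ E * e / √(1 - δ) := hlin
        _ ≤ 2 * E * e := by
            rw [div_le_iff₀ hs]
            have : 0 ≤ E * e := by positivity
            nlinarith
        _ ≤ K / m * e := by gcongr; linarith
        _ ≤ _ := by
            refine mul_le_mul_of_nonneg_left ?_ (by linarith)
            linarith
  · have hρpos : 0 < ρ := he0.trans hcase
    have hrisk' : ∑ i, q i * ε' i ≤ D * ρ := by
      refine hrisk.trans ?_
      rw [hD]; nlinarith
    have hAK : A ≤ K := by linarith
    refine ⟨?_, fun hδ2 => ?_⟩
    · have h1 := sum_mul_le_riskTransfer_div hδ0 hδ1 hqm hq1 hm hm1 he0.le hA0 (by linarith) hD1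
        hρpos hcase.le hε hε' hε'0 hg'0 hg hrisk'
      have hCK : C * (D + A) ≤ K := by
        have : C * (D + A) ≤ E := by rw [hE]; gcongr <;> linarith
        linarith
      refine hηle.trans (h1.trans ?_)
      rw [mul_add ((K / √(1 - δ)) ^ (1 / (1 - δ)))]
      exact add_le_add (by gcongr) (mul_le_mul_of_nonneg_right (by linarith) he0.le)
    · have h1 := sum_mul_le_div_mul_riskTransfer hδ0 hδ2 hqm hq1 hm hm1 he0.le hA0 (by linarith) hD1
        hρpos hcase.le hε hε' hε'0 hg'0 hg hrisk'
      have hEK : E ^ 2 ≤ K := by rw [hK]; nlinarith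
      have hF := riskTransfer_nonneg (δ := δ) hρpos.le
      refine hηle.trans (h1.trans ?_)
      rw [mul_add (K / m)]
      exact add_le_add (mul_le_mul_of_nonneg_right (by gcongr) hF)
        (mul_le_mul_of_nonneg_right (by linarith) he0.le)

end Transfer

/-! ### Well-balanced rules -/

namespace PoissonTopicModel

variable {d T : ℕ} {M : PoissonTopicModel d T} {κ : ℝ} {w : Fin d → ℝ}

lemma nonempty_topics (M : PoissonTopicModel d T) : Nonempty (Fin T) :=
  (M.topicLaw true).support_nonempty.to_type

lemma minLength_le (M : PoissonTopicModel d T) (τ : Fin T) : M.minLength ≤ M.docLength τ :=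
  ciInf_le (Set.finite_range _).bddBelow τ

lemma WellBalanced.docLength_pos (h : M.WellBalanced κ w) (τ : Fin T) : 0 < M.docLength τ := by
  have h0 : ∀ j ∈ Finset.univ, (0 : ℝ) ≤ M.rate τ j := fun j _ => (M.rate τ j).coe_nonneg
  refine (Finset.sum_nonneg h0).lt_of_ne fun hzero => (h τ).1.ne' ?_
  have hall := (Finset.sum_eq_zero_iff_of_nonneg h0).1 hzero.symm
  exact Finset.sum_eq_zero fun j hj => by rw [hall j hj, zero_mul]

lemma WellBalanced.minLength_pos (h : M.WellBalanced κ w) : 0 < M.minLength := by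
  have := M.nonempty_topics
  obtain ⟨τ, hτ⟩ := exists_eq_ciInf_of_finite (f := M.docLength)
  rw [minLength, ← hτ]
  exact h.docLength_pos τ

/-- No weight of a well-balanced rule exceeds `√κ / √λ` standard deviations. -/
lemma WellBalanced.abs_weight_le (h : M.WellBalanced κ w) (τ : Fin T) (j : Fin d) :
    |w j| ≤ √κ / √M.minLength * √(∑ j, (M.rate τ j : ℝ) * w j ^ 2) := by
  have hv := (h τ).1
  have hκ := (h τ).2
  have hl := h.minLength_pos
  rw [div_le_iff₀ hv] at hκ
  have hsup : w j ^ 2 ≤ ⨆ j, w j ^ 2 :=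
    le_ciSup (f := fun j => w j ^ 2) (Set.finite_range _).bddAbove j
  have hkey : w j ^ 2 * M.minLength ≤ κ * ∑ j, (M.rate τ j : ℝ) * w j ^ 2 :=
    (mul_le_mul hsup (M.minLength_le τ) hl.le ((sq_nonneg _).trans hsup)).trans hκ
  rw [← Real.sqrt_div' _ hl.le, ← Real.sqrt_mul' _ hv.le]
  refine Real.abs_le_sqrt ?_
  rwa [div_mul_eq_mul_div, le_div_iff₀ hl]

/-- The normal approximation to the error under topic `τ`, at dropout rate `1 - p`. -/
lemma WellBalanced.abs_error_sub_le (h : M.WellBalanced κ w) (τ : Fin T) (c : Bool) {p : ℝ≥0}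
    (hp : 0 < p) :
    |(poissonPi fun j => p * M.rate τ j).real {x | linearRule w x ≠ c} -
      gaussCDF (-(√p * signedMargin (M.rate τ) w c))| ≤
        7 * √κ * (1 / √M.minLength) / √p := by
  have hp' : 0 < (p : ℝ) := hp
  have hv : ∑ j, ((p * M.rate τ j : ℝ≥0) : ℝ) * w j ^ 2 =
      p * ∑ j, (M.rate τ j : ℝ) * w j ^ 2 := by
    rw [Finset.mul_sum]
    exact Finset.sum_congr rfl fun j _ => by push_cast; ring
  have hs : 0 < √(p : ℝ) := Real.sqrt_pos.2 hp'
  have := abs_measureReal_linearRule_ne_sub_le (fun j => p * M.rate τ j) w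
    (by rw [hv]; exact mul_pos hp' (h τ).1) (γ := √κ / √M.minLength / √p) (by positivity)
    (fun j => by
      rw [hv, Real.sqrt_mul hp'.le, ← mul_assoc, div_mul_cancel₀ _ hs.ne']
      exact h.abs_weight_le τ j) c
  rw [signedMargin_smul] at this
  refine this.trans_eq ?_
  ring

end PoissonTopicModel

/-! ### The bounds on the excess risk -/

theorem theorem2 (κ B : ℝ) (hκ : 0 < κ) (hB : 0 ≤ B) :
    ∃ K : ℝ, 0 < K ∧
      ∀ (d T : ℕ) (M : PoissonTopicModel d T) (δ : unitInterval) (pmin α : ℝ),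
        0 < (δ : ℝ) → (δ : ℝ) < 1 → 0 < pmin → 0 < α →
        (∀ τ, pmin ≤ M.topicProb τ) →
        (∀ τ c, α ≤ |M.labelProb c τ - 1 / 2|) →
        ∀ wstar : Fin d → ℝ, M.IsBestDropRule κ δ wstar →
        M.errDrop δ wstar ≤ M.errMin + B / √M.minLength →
        ∀ (n : ℕ) (sample : Fin n → (Fin d → ℕ) × Bool) (what : Fin d → ℝ),
        M.IsDropERM κ δ sample what →
        ∀ ηdrop η : ℝ,
        ηdrop = M.errDrop δ what - M.errDrop δ wstar →
        η = M.err what - M.err wstar →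
        -- for every `δ`: linear dependence on `1 / pmin` and `1 / α` in the scale of the risk
        η ≤ (K / √(1 - δ)) ^ (1 / (1 - δ : ℝ)) *
            ((ηdrop / (α * pmin)) ^ (1 / (1 - δ : ℝ)) *
              max 1 (√(-Real.log ηdrop) ^ (δ / (1 - δ) : ℝ)) + 1 / √M.minLength) ∧
        -- for `δ ≤ 1 / 2`: linear dependence on `1 / pmin` and `1 / α` of the bound itself
        ((δ : ℝ) ≤ 1 / 2 →
          η ≤ K / (α * pmin) *
            (ηdrop ^ (1 / (1 - δ : ℝ)) *
              max 1 (√(-Real.log ηdrop) ^ (δ / (1 - δ) : ℝ)) + 1 / √M.minLength)) := by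
  set A : ℝ := 7 * √κ with hA
  have hA0 : 0 ≤ A := by positivity
  refine ⟨transferConst A B tailConst, ?_, ?_⟩
  · have := two_le_tailConst
    unfold transferConst
    positivity
  intro d T M δ pmin α hδ0 hδ1 hpmin hα htopic hlabel wstar hstar hdistinct n sample what hERM
    ηdrop η hηdrop hη
  have hhat : M.WellBalanced κ what := hERM.1
  have hl : 0 < √M.minLength := Real.sqrt_pos.2 hhat.minLength_pos
  have hp : (0 : ℝ) < 1 - δ := by linarith
  have hs : 0 < √(1 - δ : ℝ) := Real.sqrt_pos.2 hp
  have hs1 : √(1 - δ : ℝ) ≤ 1 := Real.sqrt_le_one.2 (by linarith)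
  set e : ℝ := 1 / √M.minLength with he
  have he0 : 0 < e := by positivity
  set p : ℝ≥0 := unitInterval.toNNReal (unitInterval.symm δ) with hp_def
  have hpδ : (p : ℝ) = 1 - δ := by simp [hp_def]
  have hp0 : 0 < p := by rw [← NNReal.coe_pos, hpδ]; exact hp
  -- per-topic quantities: weights, errors without and with dropout, and their Gaussian proxies
  set q : Fin T → ℝ := M.topicGap with hq_def
  set ε : Fin T → ℝ := fun τ =>
    (poissonPi (M.rate τ)).real {x | linearRule what x ≠ M.bestLabel τ} with hε_def
  set ε' : Fin T → ℝ := fun τ =>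
    (poissonPi fun j => p * M.rate τ j).real {x | linearRule what x ≠ M.bestLabel τ} with hε'_def
  set z : Fin T → ℝ := fun τ => signedMargin (M.rate τ) what (M.bestLabel τ) with hz_def
  have hq : ∀ τ, 2 * (α * pmin) ≤ q τ := fun τ =>
    M.two_mul_le_topicGap hpmin hα (htopic τ) (hlabel τ)
  have hm : 0 < α * pmin := by positivity
  have hqm : ∀ τ, α * pmin ≤ q τ := fun τ => by linarith [hq τ]
  have hq0 : ∀ τ, 0 ≤ q τ := fun τ => hm.le.trans (hqm τ)
  have hq1 : ∑ τ, q τ ≤ 1 :=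
    (Finset.sum_le_sum fun τ _ => M.topicGap_le_topicProb τ).trans_eq M.sum_topicProb
  have hm1 : α * pmin ≤ 1 := by
    obtain ⟨τ⟩ := M.nonempty_topics
    exact (hqm τ).trans
      ((Finset.single_le_sum (fun i _ => hq0 i) (Finset.mem_univ τ)).trans hq1)
  have hε : ∀ τ, ε τ ≤ gaussCDF (-z τ) + A * e := fun τ => by
    have := abs_le.1 (hhat.abs_error_sub_le τ (M.bestLabel τ) one_pos)
    simp only [NNReal.coe_one, Real.sqrt_one, one_mul, div_one] at this
    simp only [hε_def, hz_def]
    linarith [this.2]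
  have hε' : ∀ τ, gaussCDF (-(√(1 - δ : ℝ) * z τ)) ≤ ε' τ + A * e / √(1 - δ : ℝ) := fun τ => by
    have := abs_le.1 (hhat.abs_error_sub_le τ (M.bestLabel τ) hp0)
    rw [hpδ] at this
    simp only [hε'_def, hz_def]
    linarith [this.1]
  have hε'0 : ∀ τ, 0 ≤ ε' τ := fun τ => measureReal_nonneg
  have hg'0 : ∀ τ, 0 ≤ gaussCDF (-(√(1 - δ : ℝ) * z τ)) := fun τ => (gaussCDF_pos _).le
  have hηdrop0 : 0 ≤ ηdrop := by rw [hηdrop]; linarith [hstar.2 what hhat]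
  have hrisk : ∑ τ, q τ * ε' τ ≤ ηdrop + B * e := by
    rw [hq_def, hε'_def, ← M.errDrop_sub_errMin δ what, hηdrop]
    have : B * e = B / √M.minLength := by rw [he]; ring
    linarith
  have hηle : η ≤ ∑ τ, q τ * ε τ := by
    rw [hq_def, hε_def, ← M.err_sub_errMin what, hη]
    have : 0 ≤ M.err wstar - M.errMin := by
      rw [M.err_sub_errMin]
      exact Finset.sum_nonneg fun τ _ => mul_nonneg (hq0 τ) measureReal_nonneg
    linarith
  exact sum_mul_le_transferConst hδ0 hδ1 hqm hq1 hm hm1 he0 hA0 hB two_le_tailConst hηdrop0 hε hε'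
    hε'0 hg'0 (fun τ => gaussCDF_neg_le_two_mul hs.le hs1)
    (fun τ => gaussCDF_neg_le_riskTransfer hδ0 hδ1 (z τ)) hrisk hηle
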